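/- Let $V$ be a simple Euclidean Jordan algebra of dimension $d$ and rank $r$, with identity $e$, Jordan trace $\mathrm{Tr}$ and determinant $\Delta$, and with the inner product normalized by $(x,y)=\mathrm{Tr}(xy)$; $dx$ is the corresponding Lebesgue measure. Extend $(\cdot,\cdot)$ complex bilinearly, and the Jordan product and $\Delta$ holomorphically, to $V_{\mathbb C}=V+iV$. Let $\Omega$ be the symmetric cone of $V$ (the interior of the set of squares), $T(\Omega)=\Omega+iV$, let $\mathbf c(z)=(e+z)(e-z)^{-1}$ be the Cayley transform, and let $\mathcal D=\mathbf c^{-1}(T(\Omega))=\{z\in V_{\mathbb C}: e-z \text{ is invertible and } \mathbf c(z)\in T(\Omega)\}$ be the associated bounded symmetric domain. Let $\nu>\frac dr-1$ be real (that is, $\nu>\frac a2(r-1)$, where $d=r+\frac a2 r(r-1)$), and put $$\Gamma_\Omega(\nu)=\int_\Omega e^{-\mathrm{Tr}(x)}\Delta(x)^{\nu-d/r}\,dx,\qquad d\mu_\nu(x)=\Delta(x)^{\nu-d/r}\,dx,\qquad \beta_\nu=\sqrt{\frac{2^{r\nu}}{\Gamma_\Omega(\nu)}} .$$ For $f\in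 L^2(\Omega,d\mu_\nu)$ and $w\in\mathcal D$ let $$\Xi(f)(w)=\beta_\nu\,\Delta(e-w)^{-\nu}\int_\Omega e^{-(\mathbf c(w),x)}f(x)\,d\mu_\nu(x),$$ where $\Delta(e-w)^{-\nu}$ is the branch of the power obtained by continuation along the segment from $0$ to $w$, with value $1$ at $w=0$. **Theorem.** Let $\mathbf E$ be a closed subspace of $L^2(\Omega,d\mu_\nu)$, $\{e_\alpha\}$ an orthonormal basis of $\mathbf E$, $E_\alpha=\Xi(e_\alpha)$, and $\mathrm{pr}_{\mathbf E}$ the orthogonal projection of $L^2(\Omega,d\mu_\nu)$ onto $\mathbf E$. Then for every $w\in\mathcal D$ the function $x\mapsto e^{-\overline{(\mathbf c(w),x)}}$ belongs to $L^2(\Omega,d\mu_\nu)$, and $$\beta_\nu\,\overline{\Delta(e-w)^{-\nu}}\;\mathrm{pr}_{\mathbf E}\bigl(e^{-\overline{(\mathbf c(w),\,\cdot\,)}}\bigr)=\sum_\alpha \overline{E_\alpha(w)}\;e_\alpha ,$$ where the sum converges (unconditionally) in the norm of $L^2(\Omega,d\mu_\nu)$. -/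

import Mathlib

open MeasureTheory
open scoped ENNReal ComplexConjugate InnerProductSpace

noncomputable section

/-- A (unital, real) Jordan algebra with an associative inner product, that is, a Euclidean Jordan
algebra once `V` is finite dimensional. The product is the bilinear map `mul`. -/
class EuclideanJordanAlgebra (V : Type*) [NormedAddCommGroup V] [InnerProductSpace ℝ V] where
  /-- the Jordan product -/
  mul : V →ₗ[ℝ] V →ₗ[ℝ] V
  /-- the identity element -/
  one : V
  mul_comm : ∀ x y, mul x y = mul y x
  one_mul : ∀ x, mul one x = x
  jordan : ∀ x y, mul x (mul (mul x x) y) = mul (mul x x) (mul x y)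
  inner_mul : ∀ x y z, ⟪mul x y, z⟫_ℝ = ⟪y, mul x z⟫_ℝ

namespace EuclideanJordanAlgebra

section Algebra

variable {V : Type*} [NormedAddCommGroup V] [InnerProductSpace ℝ V] [EuclideanJordanAlgebra V]

/-- Simplicity: `V ≠ 0` and the only ideals are `0` and `V`. -/
def IsSimple (V : Type*) [NormedAddCommGroup V] [InnerProductSpace ℝ V]
    [EuclideanJordanAlgebra V] : Prop :=
  Nontrivial V ∧ ∀ I : Submodule ℝ V, (∀ x : V, ∀ y ∈ I, mul x y ∈ I) → I = ⊥ ∨ I = ⊤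

/-- Powers `x ^ n` in the Jordan algebra. -/
def pow (x : V) : ℕ → V
  | 0 => one
  | n + 1 => mul x (pow x n)

/-- The rank: the maximal degree of the minimal polynomial of an element, i.e. the maximal
dimension of the subalgebra `ℝ[x]` spanned by the powers of `x`. -/
def rank (V : Type*) [NormedAddCommGroup V] [InnerProductSpace ℝ V]
    [EuclideanJordanAlgebra V] : ℕ :=
  ⨆ x : V, Module.finrank ℝ (Submodule.span ℝ (Set.range (pow x)))

/-- Idempotents. -/
def IsIdempotent (c : V) : Prop := mul c c = c

/-- A primitive idempotent: nonzero, and not the sum of two nonzero orthogonal idempotents. -/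
def IsPrimitive (c : V) : Prop :=
  IsIdempotent c ∧ c ≠ 0 ∧
    ∀ a b : V, IsIdempotent a → IsIdempotent b → mul a b = 0 → a + b = c → a = 0 ∨ b = 0

/-- A Jordan frame: a complete system of orthogonal primitive idempotents. -/
def IsJordanFrame {n : ℕ} (c : Fin n → V) : Prop :=
  (∀ i, IsPrimitive (c i)) ∧ (∀ i j, i ≠ j → mul (c i) (c j) = 0) ∧ ∑ i, c i = one

/-- `l` lists the eigenvalues of `x`, with multiplicity: `x = ∑ i, l i • c i` for some Jordan frame
`c`. Every element of a Euclidean Jordan algebra has such a list, unique up to order. -/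
def IsSpectrum (x : V) (l : List ℝ) : Prop :=
  ∃ c : Fin l.length → V, IsJordanFrame c ∧ x = ∑ i, l.get i • c i

open Classical in
/-- The eigenvalues of `x` with multiplicity (in some order). -/
def eigenvalues (x : V) : List ℝ := if h : ∃ l, IsSpectrum x l then h.choose else []

/-- The Jordan algebra trace `Tr`: the sum of the eigenvalues. -/
def trace (x : V) : ℝ := (eigenvalues x).sum

/-- The Jordan algebra determinant `Δ`: the product of the eigenvalues. -/
def det (x : V) : ℝ := (eigenvalues x).prod

/-- The symmetric cone `Ω`: the interior of the set of squares. -/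
def cone (V : Type*) [NormedAddCommGroup V] [InnerProductSpace ℝ V]
    [EuclideanJordanAlgebra V] : Set V :=
  interior (Set.range fun x : V => mul x x)

/-! ### The complexification

The complexification `V + iV` is modelled on `V × V`; the pair `(x, y)` stands for `x + iy`. -/

/-- The complex bilinear extension of the Jordan product. -/
def cmul (z w : V × V) : V × V :=
  (mul z.1 w.1 - mul z.2 w.2, mul z.1 w.2 + mul z.2 w.1)

/-- The identity element of the complexification. -/
def oneC : V × V := (one, 0)

/-- `(z, x)` for `z` in the complexification and `x ∈ V`: the inner product of `V`, extended
complex linearly in `z`. -/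
def cinner (z : V × V) (x : V) : ℂ := (⟪z.1, x⟫_ℝ : ℂ) + Complex.I * (⟪z.2, x⟫_ℝ : ℂ)

/-- `u` is the Jordan inverse of `z`. -/
def IsCInverse (z u : V × V) : Prop := cmul z u = oneC ∧ cmul (cmul z z) u = z

open Classical in
/-- The Jordan inverse in the complexification (`0` if `z` is not invertible). -/
def cinv (z : V × V) : V × V := if h : ∃ u, IsCInverse z u then h.choose else 0

open Classical in
/-- The holomorphic polynomial on the complexification that extends `Δ`: its value at `x + iy` is
the value at `t = i` of the polynomial `t ↦ Δ(x + t y)`. -/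
def cdet (z : V × V) : ℂ :=
  if h : ∃ p : Polynomial ℝ, ∀ t : ℝ, p.eval t = det (z.1 + t • z.2) then
    Polynomial.aeval Complex.I h.choose else 0

/-- The logarithm of `Δ(z)` obtained by continuation from `log Δ(e) = 0` along the segment
from `e` to `z`. -/
def clogDet (z : V × V) : ℂ :=
  ∫ t in (0 : ℝ)..1,
    deriv (fun s : ℝ => cdet (oneC + s • (z - oneC))) t / cdet (oneC + t • (z - oneC))

/-- The power `Δ(z)^s` for `z ∈ T(Ω)`: the holomorphic branch on the tube that is `1` at `e`, hence
positive on `Ω` for real `s`. -/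
def cdetPow (z : V × V) (s : ℂ) : ℂ := Complex.exp (s * clogDet z)

/-- The tube domain `T(Ω) = Ω + iV`. -/
def tube (V : Type*) [NormedAddCommGroup V] [InnerProductSpace ℝ V]
    [EuclideanJordanAlgebra V] : Set (V × V) :=
  {z | z.1 ∈ cone V}

/-- The Cayley transform `c(z) = (e + z)(e - z)⁻¹`. -/
def cayley (z : V × V) : V × V := cmul (oneC + z) (cinv (oneC - z))

/-- The bounded symmetric domain `𝒟`, which the Cayley transform maps onto `T(Ω)`. -/
def boundedDomain (V : Type*) [NormedAddCommGroup V] [InnerProductSpace ℝ V]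
    [EuclideanJordanAlgebra V] : Set (V × V) :=
  {z | (∃ u, IsCInverse (oneC - z) u) ∧ cayley z ∈ tube V}

end Algebra

section Analysis

variable (V : Type*) [NormedAddCommGroup V] [InnerProductSpace ℝ V] [FiniteDimensional ℝ V]
  [MeasurableSpace V] [BorelSpace V] [EuclideanJordanAlgebra V]

/-- The quotient `d / r` of dimension and rank. For a simple algebra `d = r + a r (r - 1) / 2`, with `a`
the common dimension of the off-diagonal Peirce spaces, so `d / r - 1 = a (r - 1) / 2`. -/
def dimOverRank : ℝ := (Module.finrank ℝ V : ℝ) / (rank V : ℝ)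

/-- The gamma function of the cone,
`Γ_Ω(ν) = ∫_Ω exp (-Tr x) Δ(x)^(ν - d/r) dx`. -/
def gammaCone (ν : ℝ) : ℝ :=
  ∫ x in cone V, Real.exp (-trace x) * det x ^ (ν - dimOverRank V)

/-- The measure `dμ_ν(x) = Δ(x)^(ν - d/r) dx` on the cone (extended by zero to `V`). -/
def coneMeasure (ν : ℝ) : Measure V :=
  (volume.restrict (cone V)).withDensity fun x => ENNReal.ofReal (det x ^ (ν - dimOverRank V))

/-- The Hilbert space `L²(Ω, dμ_ν)` of complex valued functions. -/
abbrev L2Cone (ν : ℝ) : Type _ := Lp ℂ 2 (coneMeasure V ν)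

/-- The constant `β_ν = √(2^(r ν) / Γ_Ω(ν))`. -/
def betaConst (ν : ℝ) : ℝ := Real.sqrt ((2 : ℝ) ^ ((rank V : ℝ) * ν) / gammaCone V ν)

variable {V}

/-- The Laplace transform `ℒ_ν f (z) = ∫_Ω exp (-(z, x)) f(x) dμ_ν(x)`. -/
def laplace (ν : ℝ) (f : L2Cone V ν) (z : V × V) : ℂ :=
  ∫ x, Complex.exp (-cinner z x) * f x ∂(coneMeasure V ν)

/-- The transform `Ξ f (w) = β_ν Δ(e - w)^(-ν) ℒ_ν f (c(w))`, a function on `𝒟`. -/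
def xi (ν : ℝ) (f : L2Cone V ν) (w : V × V) : ℂ :=
  (betaConst V ν : ℂ) * cdetPow (oneC - w) (-(ν : ℂ)) * laplace ν f (cayley w)

/-- The function `x ↦ exp (-conj (c(w), x))`. -/
def expKernel (w : V × V) (x : V) : ℂ := Complex.exp (-conj (cinner (cayley w) x))

end Analysis

end EuclideanJordanAlgebra

end

/-! Write `k` for the kernel function of `w`. The Laplace transform is the inner product against
`k`, so the conjugate of `E_α(w)` is `β_ν` times the conjugate of `Δ(e-w)^(-ν)` times `⟪e_α, k⟫`
(`conj_xi`). Since `e_α` lies in `E`, this inner product is the Fourier coefficient of the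
projection of `k`, and the asserted series is the Fourier expansion of that projection. The power of
`Δ(e-w)` is only a scalar common to both sides.

The real work is `k ∈ L²` (`memLp_expKernel`). As the real part of `c(w)` lies in the open cone, it
dominates `ε e` for some `ε > 0`, and the claim reduces to convergence of the integral of `exp(-ε
(x,e)) Δ(x)^p` over the cone for every `p > -1` (`lintegral_gammaIntegrand_lt_top`). This goes by
induction on the dimension. For a primitive idempotent `c`, split `x = t c + u + v` by the Peirce
decomposition; completing the square gives `Δ(x) = t Δ₀(v - q(u)/t)`, with `q(u)` the `V₀(c)` part
of `u²` and `Δ₀` the determinant of `V₀(c)`. After a translation in `v` the integral is bounded by a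
product of one in `t`, one in `u`, and the same integral for `V₀(c)` with the same `p`.

Since `Δ` is defined from a chosen spectral decomposition, its analytic properties all come from
Klein's inequality (`sum_log_sub_sum_log_le`): independence of the frame, concavity and continuity
of `log Δ`, and its constancy along the flow that completes the square. -/

noncomputable section

namespace EuclideanJordanAlgebra

/-! ### Polarized Jordan identities -/

section Identities

variable {V : Type*} [NormedAddCommGroup V] [InnerProductSpace ℝ V] [EuclideanJordanAlgebra V]

theorem mul_one' (x : V) : mul x one = x := by rw [mul_comm, one_mul]

theorem inner_mul_left (x y z : V) : ⟪mul x y, z⟫_ℝ = ⟪x, mul y z⟫_ℝ := by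
  rw [mul_comm, inner_mul]

theorem inner_mul_right (x y z : V) : ⟪x, mul y z⟫_ℝ = ⟪mul y x, z⟫_ℝ := by
  rw [inner_mul]

/-- The linearized Jordan identity. -/
theorem jordan_linearized (x y z w : V) :
    mul x (mul (mul y z) w) + mul y (mul (mul x z) w) + mul z (mul (mul x y) w) =
      mul (mul y z) (mul x w) + mul (mul x z) (mul y w) + mul (mul x y) (mul z w) := by
  have hx := jordan x w
  have hy := jordan y w
  have hz := jordan z w
  have hxy := jordan (x + y) w
  have hxz := jordan (x + z) w
  have hyz := jordan (y + z) w
  have hxyz := jordan (x + y + z) w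
  simp only [map_add, LinearMap.add_apply, mul_comm y x, mul_comm z x, mul_comm z y] at *
  -- The Jordan identity is cubic in its first variable; inclusion-exclusion over `x, y, z` extracts
  -- the trilinear part, where every term occurs twice.
  linear_combination (norm := module) (1/2 : ℝ) • (hxyz - hxy - hxz - hyz + hx + hy + hz)

/-- The operator form of the linearized Jordan identity. -/
theorem mul_sq_mul (x z y : V) :
    mul (mul (mul x x) z) y - mul (mul x x) (mul z y) =
      (2 : ℝ) • (mul (mul x z) (mul x y) - mul x (mul z (mul x y))) := by
  have h := jordan_linearized x x y z
  rw [mul_comm z y, mul_comm (mul (mul x x) z) y, mul_comm (mul x z) (mul x y),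
    mul_comm z (mul x y)]
  linear_combination (norm := module) h

end Identities
-- Idempotents and Peirce rules
section Peirce

variable {V : Type*} [NormedAddCommGroup V] [InnerProductSpace ℝ V] [EuclideanJordanAlgebra V]

/-- This confines the eigenvalues of multiplication by `c` to `0`, `1/2` and `1`. -/
theorem IsIdempotent.peirce_cubic {c : V} (hc : IsIdempotent c) (y : V) :
    mul c y - (3 : ℝ) • mul c (mul c y) + (2 : ℝ) • mul c (mul c (mul c y)) = 0 := by
  have h := mul_sq_mul c c y
  have hc' : mul c c = c := hc
  simp only [hc'] at h
  linear_combination (norm := module) h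

/-- Multiplication by an idempotent is a positive operator. -/
theorem IsIdempotent.inner_mul_self_eq {c : V} (hc : IsIdempotent c) (y : V) :
    ⟪mul c y, y⟫_ℝ = ‖(2 : ℝ) • mul c (mul c y) - mul c y‖ ^ 2 +
      (1 / 2) * ‖(4 : ℝ) • mul c y - (4 : ℝ) • mul c (mul c y)‖ ^ 2 := by
  have h1 := hc.peirce_cubic y
  have h2 := hc.peirce_cubic (mul c y)
  -- With `L` the multiplication by `c`, the operators `2L² - L` and `4L - 4L²` are the projections
  -- onto the Peirce `1`- and `1/2`-spaces, so the right side is `‖y₁‖² + ‖y_{1/2}‖² / 2`.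
  have a1 : mul c (mul c (mul c y)) =
      (1 / 2 : ℝ) • ((3 : ℝ) • mul c (mul c y) - mul c y) := by
    linear_combination (norm := module) (1 / 2 : ℝ) • h1
  rw [← real_inner_self_eq_norm_sq, ← real_inner_self_eq_norm_sq]
  simp only [inner_sub_left, inner_sub_right, inner_smul_left, inner_smul_right,
    inner_mul_right, a1]
  simp only [conj_trivial]
  ring

theorem IsIdempotent.inner_mul_self_nonneg {c : V} (hc : IsIdempotent c) (y : V) :
    0 ≤ ⟪mul c y, y⟫_ℝ := by
  rw [hc.inner_mul_self_eq]; positivity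

theorem IsIdempotent.mul_eq_zero_of_inner {c y : V} (hc : IsIdempotent c)
    (h : ⟪mul c y, y⟫_ℝ = 0) : mul c y = 0 := by
  rw [hc.inner_mul_self_eq] at h
  have h1 : ‖(2 : ℝ) • mul c (mul c y) - mul c y‖ ^ 2 = 0 := by
    have := sq_nonneg ‖(2 : ℝ) • mul c (mul c y) - mul c y‖
    have := sq_nonneg ‖(4 : ℝ) • mul c y - (4 : ℝ) • mul c (mul c y)‖
    linarith
  have h2 : ‖(4 : ℝ) • mul c y - (4 : ℝ) • mul c (mul c y)‖ ^ 2 = 0 := by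
    linarith
  rw [sq_eq_zero_iff, norm_eq_zero] at h1 h2
  linear_combination (norm := module) h1 + (1 / 2 : ℝ) • h2

/-- Idempotents pair nonnegatively with squares. -/
theorem IsIdempotent.inner_sq_nonneg {c : V} (hc : IsIdempotent c) (y : V) :
    0 ≤ ⟪c, mul y y⟫_ℝ := by
  rw [inner_mul_right, mul_comm]; exact hc.inner_mul_self_nonneg y

theorem IsIdempotent.inner_nonneg {c d : V} (hc : IsIdempotent c) (hd : IsIdempotent d) :
    0 ≤ ⟪c, d⟫_ℝ := by
  have h := hc.inner_sq_nonneg d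
  rwa [show mul d d = d from hd] at h

theorem IsIdempotent.mul_eq_zero {c d : V} (hc : IsIdempotent c) (hd : IsIdempotent d)
    (h : ⟪c, d⟫_ℝ = 0) : mul c d = 0 := by
  apply hc.mul_eq_zero_of_inner
  rw [inner_mul_left, show mul d d = d from hd, h]

theorem IsIdempotent.sub {a c : V} (hc : IsIdempotent c) (ha : IsIdempotent a)
    (h : mul c a = a) : IsIdempotent (c - a) := by
  have ha' : mul a a = a := ha
  have hc' : mul c c = c := hc
  simp [IsIdempotent, ha', hc', h, mul_comm a c]

theorem isIdempotent_one : IsIdempotent (one : V) := one_mul _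

theorem IsIdempotent.inner_one {c : V} (hc : IsIdempotent c) : ⟪c, one⟫_ℝ = ⟪c, c⟫_ℝ := by
  nth_rewrite 1 [← show mul c c = c from hc]
  rw [inner_mul_left, mul_one']

/-- Summands of an idempotent orthogonal to `d` are orthogonal to `d`. -/
theorem IsIdempotent.mul_eq_zero_of_add {a b d : V} (ha : IsIdempotent a) (hb : IsIdempotent b)
    (hd : IsIdempotent d) (h : mul (a + b) d = 0) : mul a d = 0 := by
  apply ha.mul_eq_zero hd
  have h0 : ⟪a, d⟫_ℝ + ⟪b, d⟫_ℝ = 0 := by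
    rw [← inner_add_left, ← show mul d d = d from hd, inner_mul_right, mul_comm, h, inner_zero_left]
  have := ha.inner_nonneg hd
  have := hb.inner_nonneg hd
  linarith

/-- Multiplication by an element of the Peirce `1`- or `0`-space commutes with multiplication by the
idempotent. -/
theorem IsIdempotent.commute_of_eigen {c : V} (hc : IsIdempotent c) {y : V} {μ : ℝ}
    (hμ : μ ≠ 1 / 2) (hy : mul c y = μ • y) (z : V) :
    mul c (mul y z) = mul y (mul c z) := by
  have h := jordan_linearized c c y z
  rw [show mul c c = c from hc, hy] at h
  simp only [map_smul, LinearMap.smul_apply] at h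
  have h2 : (1 - 2 * μ) • (mul c (mul y z) - mul y (mul c z)) = 0 := by
    linear_combination (norm := module) -h
  rcases smul_eq_zero.1 h2 with h3 | h3
  · exact absurd (by linarith) hμ
  · exact sub_eq_zero.1 h3

/-- The Peirce rule that `V_{1/2} · V_{1/2}` lies in `V₀ ⊕ V₁`, where multiplication by `c` is a
projection. -/
theorem IsIdempotent.half_mul_half {c : V} (hc : IsIdempotent c) {x y : V}
    (hx : mul c x = (1 / 2 : ℝ) • x) (hy : mul c y = (1 / 2 : ℝ) • y) :
    mul c (mul c (mul x y)) = mul c (mul x y) := by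
  have h := jordan_linearized x y c c
  rw [mul_comm y c, mul_comm x c, hx, hy, show mul c c = c from hc, mul_comm (mul x y) c] at h
  simp only [map_smul, LinearMap.smul_apply, mul_comm y c, mul_comm x c, hx, hy,
    mul_comm y x] at h
  linear_combination (norm := module) h

/-- Multiplications by orthogonal idempotents commute. -/
theorem IsIdempotent.commute_of_mul_eq_zero {c d : V} (hc : IsIdempotent c)
    (h : mul c d = 0) (z : V) : mul c (mul d z) = mul d (mul c z) :=
  hc.commute_of_eigen (μ := 0) (by norm_num) (by rw [h, zero_smul]) z

end Peirce

/-! ### Power associativity and the spectral theorem -/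

section Spectral

variable {V : Type*} [NormedAddCommGroup V] [InnerProductSpace ℝ V] [EuclideanJordanAlgebra V]

open Polynomial

theorem commute_mul_mul_sq (x : V) :
    Commute (mul x : Module.End ℝ V) (mul (mul x x)) := by
  ext y; exact jordan x y

/-- With `z = xⁿ`, `mul_sq_mul` expresses multiplication by `xⁿ⁺²` through the multiplications by
`x`, `x²`, `xⁿ` and `xⁿ⁺¹`. Inductively everything is generated by the multiplications by `x` and
`x²`, which commute by the Jordan identity. -/
theorem commute_mul_pow (x : V) (n : ℕ) :
    Commute (mul (((mul x : Module.End ℝ V) ^ n) one) : Module.End ℝ V) (mul x) ∧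
      Commute (mul (((mul x : Module.End ℝ V) ^ n) one) : Module.End ℝ V) (mul (mul x x)) := by
  induction n using Nat.strong_induction_on with
  | _ n ih =>
    match n with
    | 0 =>
      have h : (mul (((mul x : Module.End ℝ V) ^ 0) one) : Module.End ℝ V) = 1 := by
        ext y; simp [one_mul]
      rw [h]; exact ⟨Commute.one_left _, Commute.one_left _⟩
    | 1 =>
      have h : (mul (((mul x : Module.End ℝ V) ^ 1) one) : Module.End ℝ V) = mul x := by
        rw [pow_one, mul_one']
      rw [h]; exact ⟨Commute.refl _, commute_mul_mul_sq x⟩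
    | n + 2 =>
      set z := ((mul x : Module.End ℝ V) ^ n) one with hz
      have hz1 : ((mul x : Module.End ℝ V) ^ (n + 1)) one = mul x z := by
        rw [pow_succ', Module.End.mul_apply]
      have hz2 : ((mul x : Module.End ℝ V) ^ (n + 2)) one = mul (mul x x) z := by
        have h0 := (ih n (by omega)).2
        have h1 : mul (mul x x) z = mul z (mul x x) := mul_comm _ _
        have h2 := LinearMap.congr_fun ((ih n (by omega)).1.eq) x
        simp only [Module.End.mul_apply] at h2
        rw [h1, h2, pow_succ', pow_succ', Module.End.mul_apply, Module.End.mul_apply,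
          mul_comm z x]
      have key : (mul (mul (mul x x) z) : Module.End ℝ V) =
          (mul (mul x x) : Module.End ℝ V) * mul z +
            (2 : ℝ) • ((mul (mul x z) : Module.End ℝ V) * mul x -
              (mul x : Module.End ℝ V) * mul z * mul x) := by
        ext y
        have h := mul_sq_mul x z y
        simp only [LinearMap.add_apply, Module.End.mul_apply, LinearMap.smul_apply,
          LinearMap.sub_apply]
        linear_combination (norm := module) h
      obtain ⟨a1, a2⟩ := ih n (by omega)
      obtain ⟨b1, b2⟩ := ih (n + 1) (by omega)
      rw [hz1] at b1 b2
      have s := commute_mul_mul_sq x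
      rw [hz2, key]
      refine ⟨?_, ?_⟩
      · exact (s.symm.mul_left a1).add_left ((((b1.mul_left (Commute.refl _)).sub_left
          (((Commute.refl _).mul_left a1).mul_left (Commute.refl _)))).smul_left _)
      · exact ((Commute.refl _).mul_left a2).add_left ((((b2.mul_left s).sub_left
          ((s.mul_left a2).mul_left s))).smul_left _)

/-- Power associativity: polynomials in `x` multiply as polynomials. -/
theorem mul_aeval_aeval (x : V) (p q : ℝ[X]) :
    mul (aeval (mul x : Module.End ℝ V) p one) (aeval (mul x : Module.End ℝ V) q one) =
      aeval (mul x : Module.End ℝ V) q (aeval (mul x : Module.End ℝ V) p one) := by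
  have h : Commute (mul x : Module.End ℝ V)
      (mul (aeval (mul x : Module.End ℝ V) p one) : Module.End ℝ V) := by
    induction p using Polynomial.induction_on' with
    | add p q hp hq =>
      simp only [map_add, LinearMap.add_apply]
      exact hp.add_right hq
    | monomial n a =>
      rw [aeval_monomial, Module.algebraMap_end_eq_smul_id]
      simp only [Module.End.mul_apply, LinearMap.smul_apply, LinearMap.id_apply, map_smul]
      exact ((commute_mul_pow x n).1.symm).smul_right a
  have h2 : Commute (aeval (mul x : Module.End ℝ V) q)
      (mul (aeval (mul x : Module.End ℝ V) p one) : Module.End ℝ V) := by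
    induction q using Polynomial.induction_on' with
    | add p q hp hq => rw [map_add]; exact hp.add_left hq
    | monomial n a =>
      rw [aeval_monomial]
      exact (Algebra.commute_algebraMap_left _ _).mul_left (h.pow_left n)
  have h3 := LinearMap.congr_fun h2.eq one
  simp only [Module.End.mul_apply, mul_one'] at h3
  exact h3.symm

/-- A complete system of orthogonal nonzero idempotents. -/
structure IsCompleteSystem {ι : Type*} [Fintype ι] (c : ι → V) : Prop where
  idem : ∀ i, IsIdempotent (c i)
  ne_zero : ∀ i, c i ≠ 0
  orth : ∀ i j, i ≠ j → mul (c i) (c j) = 0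
  sum : ∑ i, c i = one

theorem isSymmetric_mul (x : V) : (mul x : Module.End ℝ V).IsSymmetric := fun y z => by
  rw [inner_mul]

/-- Multiplication by `x` is symmetric, so `e` splits into eigenvectors. Each is a Lagrange
polynomial in `x`, and power associativity then makes these components orthogonal idempotents;
applying the operator to `e` recovers `x`. -/
theorem exists_completeSystem [FiniteDimensional ℝ V] (x : V) :
    ∃ (S : Finset ℝ) (c : S → V), IsCompleteSystem c ∧ x = ∑ i : S, (i : ℝ) • c i := by
  classical
  set T : Module.End ℝ V := mul x with hT
  have htop : (one : V) ∈ ⨆ μ : ℝ, Module.End.eigenspace T μ := by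
    have := (isSymmetric_mul x).orthogonalComplement_iSup_eigenspaces_eq_bot
    rw [Submodule.orthogonal_eq_bot_iff] at this
    rw [hT, this]; trivial
  obtain ⟨f, hf, hsum⟩ := (Submodule.mem_iSup_iff_exists_finsupp _ _).1 htop
  rw [Finsupp.sum] at hsum
  have heig : ∀ (p : ℝ[X]) (μ : ℝ), aeval T p (f μ) = p.eval μ • f μ := by
    intro p μ
    by_cases h0 : f μ = 0
    · simp [h0]
    · exact Module.End.aeval_apply_of_hasEigenvector ⟨hf μ, h0⟩
  have hpol : ∀ μ ∈ f.support, f μ = aeval T (Lagrange.basis f.support id μ) one := by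
    intro μ hμ
    rw [← hsum, map_sum, Finset.sum_congr rfl fun ν _ => heig _ ν, Finset.sum_eq_single μ]
    · have := Lagrange.eval_basis_self (s := f.support) (v := id) Function.injective_id.injOn hμ
      simp only [id] at this
      simp [this]
    · intro ν hν hne
      have := Lagrange.eval_basis_of_ne (s := f.support) (v := id) hne.symm hν
      simp only [id] at this
      simp [this]
    · exact fun h => absurd hμ h
  have hmul : ∀ μ ∈ f.support, ∀ ν ∈ f.support,
      mul (f μ) (f ν) = (Lagrange.basis f.support id ν).eval μ • f μ := by
    intro μ hμ ν hν
    rw [← heig]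
    conv_lhs => rw [hpol μ hμ, hpol ν hν]
    rw [mul_aeval_aeval, ← hpol μ hμ]
  refine ⟨f.support, fun i => f i, ⟨?_, ?_, ?_, ?_⟩, ?_⟩
  · intro i
    have := Lagrange.eval_basis_self (s := f.support) (v := id) Function.injective_id.injOn i.2
    simp only [id] at this
    rw [IsIdempotent, hmul i i.2 i i.2, this, one_smul]
  · exact fun i => Finsupp.mem_support_iff.1 i.2
  · intro i j hij
    have := Lagrange.eval_basis_of_ne (s := f.support) (v := id) (i := (j : ℝ)) (j := i)
      (fun h => hij (Subtype.ext h.symm)) i.2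
    simp only [id] at this
    rw [hmul i i.2 j j.2, this, zero_smul]
  · rw [← hsum, ← Finset.sum_coe_sort f.support]
  · have h1 : x = T one := by rw [hT, mul_one']
    rw [h1, ← hsum, map_sum, ← Finset.sum_coe_sort]
    refine Finset.sum_congr rfl fun i _ => ?_
    exact Module.End.mem_eigenspace_iff.1 (hf i)

theorem IsCompleteSystem.inner_eq_zero {ι : Type*} [Fintype ι] {c : ι → V}
    (h : IsCompleteSystem c) {i j : ι} (hij : i ≠ j) : ⟪c i, c j⟫_ℝ = 0 := by
  rw [← show mul (c j) (c j) = c j from h.idem j, inner_mul_right, mul_comm, h.orth i j hij,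
    inner_zero_left]

theorem IsCompleteSystem.card_le [FiniteDimensional ℝ V] {ι : Type*} [Fintype ι] {c : ι → V}
    (h : IsCompleteSystem c) : Fintype.card ι ≤ Module.finrank ℝ V :=
  (linearIndependent_of_ne_zero_of_inner_eq_zero (𝕜 := ℝ) h.ne_zero
    fun _ _ hij => h.inner_eq_zero hij).fintype_card_le_finrank

/-- Keep splitting nonprimitive idempotents. A complete system has at most `dim V` members, so the
process stops; `k` bounds the number of splittings left. -/
theorem IsCompleteSystem.exists_primitive [FiniteDimensional ℝ V] (k : ℕ) :
    ∀ {ι : Type} [Fintype ι] {c : ι → V} (_ : IsCompleteSystem c) (l : ι → ℝ),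
      Module.finrank ℝ V < Fintype.card ι + k →
      ∃ (κ : Type) (_ : Fintype κ) (d : κ → V) (m : κ → ℝ), IsCompleteSystem d ∧
        (∀ i, IsPrimitive (d i)) ∧ ∑ i, l i • c i = ∑ i, m i • d i := by
  classical
  induction k with
  | zero =>
    intro ι _ c hc l hk
    have := hc.card_le
    omega
  | succ k ih =>
    intro ι _ c hc l hk
    by_cases hp : ∀ i, IsPrimitive (c i)
    · exact ⟨ι, _, c, l, hc, hp, rfl⟩
    push Not at hp
    obtain ⟨i, hi⟩ := hp
    have hi' : ∃ a b : V, IsIdempotent a ∧ IsIdempotent b ∧ mul a b = 0 ∧ a + b = c i ∧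
        a ≠ 0 ∧ b ≠ 0 := by
      by_contra hcon
      push Not at hcon
      refine hi ⟨hc.idem i, hc.ne_zero i, fun a b ha hb hab hs => ?_⟩
      by_contra h0
      push Not at h0
      exact h0.2 (hcon a b ha hb hab hs h0.1)
    obtain ⟨a, b, ha, hb, hab, hs, ha0, hb0⟩ := hi'
    have hba : mul b a = 0 := by rw [mul_comm, hab]
    have haj : ∀ j, j ≠ i → mul a (c j) = 0 := fun j hj =>
      ha.mul_eq_zero_of_add hb (hc.idem j) (by rw [hs, hc.orth i j hj.symm])
    have hbj : ∀ j, j ≠ i → mul b (c j) = 0 := fun j hj =>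
      hb.mul_eq_zero_of_add ha (hc.idem j) (by rw [add_comm, hs, hc.orth i j hj.symm])
    have hsub : c i - b = a := by rw [← hs, add_sub_cancel_right]
    -- The piece `a` takes the place of `c i`, and `b` gets the new index `none`.
    let d : Option ι → V := fun o => o.elim b fun j => c j - if j = i then b else 0
    have hdi : d (some i) = a := by simp [d, hsub]
    have hdj : ∀ j, j ≠ i → d (some j) = c j := fun j hj => by simp [d, hj]
    have hdn : d none = b := rfl
    have hd : IsCompleteSystem d := by
      refine ⟨?_, ?_, ?_, ?_⟩
      · rintro (_ | j)
        · exact hb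
        · by_cases hj : j = i
          · rw [hj, hdi]; exact ha
          · rw [hdj j hj]; exact hc.idem j
      · rintro (_ | j)
        · exact hb0
        · by_cases hj : j = i
          · rw [hj, hdi]; exact ha0
          · rw [hdj j hj]; exact hc.ne_zero j
      · rintro (_ | j) (_ | j') hjj
        · exact absurd rfl hjj
        · by_cases hj : j' = i
          · rw [hj, hdi, hdn, hba]
          · rw [hdj j' hj, hdn, hbj j' hj]
        · by_cases hj : j = i
          · rw [hj, hdi, hdn, hab]
          · rw [hdj j hj, hdn, mul_comm, hbj j hj]
        · by_cases hj : j = i <;> by_cases hj' : j' = i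
          · exact absurd (by rw [hj, hj']) hjj
          · rw [hj, hdi, hdj j' hj', haj j' hj']
          · rw [hj', hdi, hdj j hj, mul_comm, haj j hj]
          · rw [hdj j hj, hdj j' hj', hc.orth j j' fun h => hjj (by rw [h])]
      · simp [Fintype.sum_option, d, hc.sum]
    obtain ⟨κ, _, d', m, h1, h2, h3⟩ := ih hd (fun o => o.elim (l i) l)
      (by rw [Fintype.card_option]; omega)
    refine ⟨κ, _, d', m, h1, h2, ?_⟩
    rw [← h3]
    simp [Fintype.sum_option, d, smul_sub]

/-- The spectral theorem. -/
theorem exists_jordanFrame [FiniteDimensional ℝ V] (x : V) :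
    ∃ (n : ℕ) (c : Fin n → V) (l : Fin n → ℝ), IsJordanFrame c ∧ x = ∑ i, l i • c i := by
  obtain ⟨S, c, hc, hx⟩ := exists_completeSystem x
  obtain ⟨κ, _, d, m, h1, h2, h3⟩ :=
    hc.exists_primitive (Module.finrank ℝ V + 1) (fun i => (i : ℝ)) (by omega)
  let φ := Fintype.equivFin κ
  refine ⟨Fintype.card κ, d ∘ φ.symm, m ∘ φ.symm, ⟨fun i => h2 _, fun i j hij =>
    h1.orth _ _ fun h => hij (φ.symm.injective h), ?_⟩, ?_⟩
  · rw [← h1.sum]; exact φ.symm.sum_comp d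
  · rw [hx, h3]; exact (φ.symm.sum_comp fun i => m i • d i).symm

theorem exists_isSpectrum [FiniteDimensional ℝ V] (x : V) : ∃ l, IsSpectrum x l := by
  obtain ⟨n, c, l, hc, hx⟩ := exists_jordanFrame x
  have hn : (List.ofFn l).length = n := List.length_ofFn
  refine ⟨List.ofFn l, c ∘ Fin.cast hn, ⟨fun i => hc.1 _, fun i j hij => hc.2.1 _ _ fun h =>
    hij (Fin.cast_injective hn h), ?_⟩, ?_⟩
  · rw [← hc.2.2]; exact (finCongr hn).sum_comp c
  · rw [hx, ← (finCongr hn).sum_comp]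
    refine Finset.sum_congr rfl fun i _ => ?_
    simp
    rfl

/-- The eigenvalues come with a Jordan frame; trace and determinant are computed from it. -/
theorem exists_jordanFrame_eigenvalues [FiniteDimensional ℝ V] (x : V) :
    ∃ (n : ℕ) (c : Fin n → V) (l : Fin n → ℝ), IsJordanFrame c ∧ x = ∑ i, l i • c i ∧
      trace x = ∑ i, l i ∧ det x = ∏ i, l i := by
  have h := exists_isSpectrum x
  have he : eigenvalues x = h.choose := by rw [eigenvalues, dif_pos h]
  obtain ⟨c, hc, hx⟩ := h.choose_spec
  refine ⟨_, c, h.choose.get, hc, hx, ?_, ?_⟩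
  · rw [trace, he, ← List.sum_ofFn, List.ofFn_get]
  · rw [det, he, ← List.prod_ofFn, List.ofFn_get]

end Spectral
-- The symmetric cone in spectral terms
section Cone

variable {V : Type*} [NormedAddCommGroup V] [InnerProductSpace ℝ V] [EuclideanJordanAlgebra V]

/-- The normalization of the inner product under which primitive idempotents are unit vectors. -/
def IsNormalized (V : Type*) [NormedAddCommGroup V] [InnerProductSpace ℝ V]
    [EuclideanJordanAlgebra V] : Prop :=
  ∀ c : V, IsPrimitive c → ⟪c, c⟫_ℝ = 1

theorem IsJordanFrame.completeSystem {n : ℕ} {c : Fin n → V} (h : IsJordanFrame c) :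
    IsCompleteSystem c :=
  ⟨fun i => (h.1 i).1, fun i => (h.1 i).2.1, h.2.1, h.2.2⟩

theorem IsJordanFrame.inner_eq_zero {n : ℕ} {c : Fin n → V} (h : IsJordanFrame c) {i j : Fin n}
    (hij : i ≠ j) : ⟪c i, c j⟫_ℝ = 0 :=
  h.completeSystem.inner_eq_zero hij

theorem IsJordanFrame.mul_sum_smul {n : ℕ} {c : Fin n → V} (h : IsJordanFrame c) (l : Fin n → ℝ)
    (i : Fin n) : mul (c i) (∑ j, l j • c j) = l i • c i := by
  rw [map_sum, Finset.sum_eq_single i]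
  · rw [map_smul, show mul (c i) (c i) = c i from h.completeSystem.idem i]
  · intro j _ hj
    rw [map_smul, h.2.1 i j hj.symm, smul_zero]
  · simp

theorem IsJordanFrame.mul_sum_sum {n : ℕ} {c : Fin n → V} (h : IsJordanFrame c)
    (l m : Fin n → ℝ) :
    mul (∑ i, l i • c i) (∑ j, m j • c j) = ∑ i, (l i * m i) • c i := by
  rw [map_sum (mul : V →ₗ[ℝ] V →ₗ[ℝ] V), LinearMap.sum_apply]
  refine Finset.sum_congr rfl fun i _ => ?_
  rw [map_smul, LinearMap.smul_apply, h.mul_sum_smul, smul_smul]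

/-- A trace form is normalized. -/
theorem isNormalized_of_trace [FiniteDimensional ℝ V]
    (h : ∀ x y : V, ⟪x, y⟫_ℝ = trace (mul x y)) : IsNormalized V := by
  intro c hc
  obtain ⟨n, d, l, hd, hx, ht, -⟩ := exists_jordanFrame_eigenvalues c
  have hcc : mul c c = c := hc.1
  rw [h, hcc, ht]
  -- Comparing `c` with `c²` in the frame. One eigenvalue must then be `1`, and primitivity forces
  -- `c = d i`, so the trace is `1` whichever frame was chosen.
  have hl : ∀ i, l i = 0 ∨ l i = 1 := by
    intro i
    have h1 : mul (d i) c = l i • d i := by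
      conv_lhs => rw [hx]
      exact hd.mul_sum_smul l i
    have h2 : mul (d i) c = (l i * l i) • d i := by
      conv_lhs => rw [← hcc, hx]
      rw [hd.mul_sum_sum]
      exact hd.mul_sum_smul _ i
    rw [h1] at h2
    have h3 : (l i * (1 - l i)) • d i = 0 := by linear_combination (norm := module) h2
    rcases smul_eq_zero.1 h3 with h4 | h4
    · rcases mul_eq_zero.1 h4 with h5 | h5
      · exact Or.inl h5
      · exact Or.inr (by linarith)
    · exact absurd h4 (hd.completeSystem.ne_zero i)
  have hex : ∃ i, l i = 1 := by
    by_contra hcon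
    push Not at hcon
    apply hc.2.1
    rw [hx]
    exact Finset.sum_eq_zero fun i _ => by rw [(hl i).resolve_right (hcon i), zero_smul]
  obtain ⟨i, hi⟩ := hex
  have hci : mul c (d i) = d i := by
    rw [mul_comm]; conv_lhs => rw [hx]
    rw [hd.mul_sum_smul, hi, one_smul]
  have hii : mul (d i) (d i) = d i := hd.completeSystem.idem i
  have hrest : c - d i = 0 := by
    refine (hc.2.2 (d i) (c - d i) hii (hc.1.sub hii hci) ?_ (by abel)).resolve_left
      (hd.completeSystem.ne_zero i)
    rw [map_sub, mul_comm, hci, hii, sub_self]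
  rw [Finset.sum_eq_single i, hi]
  · intro j _ hj
    have h1 : mul (d j) c = l j • d j := by
      conv_lhs => rw [hx]
      exact hd.mul_sum_smul l j
    rw [sub_eq_zero.1 hrest, hd.2.1 j i hj] at h1
    exact (smul_eq_zero.1 h1.symm).resolve_right (hd.completeSystem.ne_zero j)
  · simp

theorem IsJordanFrame.inner_self (hN : IsNormalized V) {n : ℕ} {c : Fin n → V}
    (h : IsJordanFrame c) (i : Fin n) : ⟪c i, c i⟫_ℝ = 1 := hN _ (h.1 i)

theorem IsJordanFrame.inner_one (hN : IsNormalized V) {n : ℕ} {c : Fin n → V}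
    (h : IsJordanFrame c) (i : Fin n) : ⟪c i, one⟫_ℝ = 1 := by
  rw [(h.completeSystem.idem i).inner_one, h.inner_self hN]

theorem IsJordanFrame.norm_eq (hN : IsNormalized V) {n : ℕ} {c : Fin n → V}
    (h : IsJordanFrame c) (i : Fin n) : ‖c i‖ = 1 := by
  have := h.inner_self hN i
  rw [real_inner_self_eq_norm_sq] at this
  exact (pow_eq_one_iff_of_nonneg (norm_nonneg _) two_ne_zero).1 this

theorem IsJordanFrame.inner_sum (hN : IsNormalized V) {n : ℕ} {c : Fin n → V}
    (h : IsJordanFrame c) (l : Fin n → ℝ) (i : Fin n) : ⟪∑ j, l j • c j, c i⟫_ℝ = l i := by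
  rw [_root_.sum_inner, Finset.sum_eq_single i]
  · rw [real_inner_smul_left, h.inner_self hN, mul_one]
  · intro j _ hj
    rw [real_inner_smul_left, h.inner_eq_zero hj, mul_zero]
  · simp

/-- The closed cone, described as the dual of the set of squares. -/
def closedCone (V : Type*) [NormedAddCommGroup V] [InnerProductSpace ℝ V]
    [EuclideanJordanAlgebra V] : Set V :=
  {x | ∀ y, 0 ≤ ⟪x, mul y y⟫_ℝ}

theorem inner_idempotent_nonneg {x c : V} (hx : x ∈ closedCone V) (hc : IsIdempotent c) :
    0 ≤ ⟪x, c⟫_ℝ := by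
  have := hx c
  rwa [show mul c c = c from hc] at this

theorem add_mem_closedCone {x y : V} (hx : x ∈ closedCone V) (hy : y ∈ closedCone V) :
    x + y ∈ closedCone V := fun z => by
  rw [inner_add_left]; exact add_nonneg (hx z) (hy z)

theorem smul_mem_closedCone {x : V} {t : ℝ} (ht : 0 ≤ t) (hx : x ∈ closedCone V) :
    t • x ∈ closedCone V := fun z => by
  rw [real_inner_smul_left]; exact mul_nonneg ht (hx z)

theorem sum_mem_closedCone {n : ℕ} {c : Fin n → V} (h : IsJordanFrame c) {l : Fin n → ℝ}
    (hl : ∀ i, 0 ≤ l i) : ∑ i, l i • c i ∈ closedCone V := fun z => by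
  rw [_root_.sum_inner]
  exact Finset.sum_nonneg fun i _ => by
    rw [real_inner_smul_left]
    exact mul_nonneg (hl i) ((h.completeSystem.idem i).inner_sq_nonneg z)

theorem isClosed_closedCone : IsClosed (closedCone V) := by
  have : closedCone V = ⋂ y : V, {x | 0 ≤ ⟪x, mul y y⟫_ℝ} := by
    ext x; simp [closedCone]
  rw [this]
  exact isClosed_iInter fun y => isClosed_le continuous_const (by fun_prop)

theorem sum_mem_closedCone_iff (hN : IsNormalized V) {n : ℕ} {c : Fin n → V}
    (h : IsJordanFrame c) {l : Fin n → ℝ} : ∑ i, l i • c i ∈ closedCone V ↔ ∀ i, 0 ≤ l i := by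
  refine ⟨fun hx i => ?_, sum_mem_closedCone h⟩
  rw [← h.inner_sum hN l i]
  exact inner_idempotent_nonneg hx (h.completeSystem.idem i)

theorem sub_smul_one_mem_closedCone_iff (hN : IsNormalized V) {n : ℕ} {c : Fin n → V}
    (h : IsJordanFrame c) {l : Fin n → ℝ} {δ : ℝ} :
    ∑ i, l i • c i - δ • one ∈ closedCone V ↔ ∀ i, δ ≤ l i := by
  rw [← h.2.2, Finset.smul_sum, ← Finset.sum_sub_distrib]
  simp only [← sub_smul]
  rw [sum_mem_closedCone_iff hN h]
  simp only [sub_nonneg]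

/-- Self-duality: membership in the dual cone means nonnegative eigenvalues, whose square roots give
a square root of the element. -/
theorem range_sq_eq_closedCone [FiniteDimensional ℝ V] (hN : IsNormalized V) :
    Set.range (fun x : V => mul x x) = closedCone V := by
  ext x
  constructor
  · rintro ⟨y, rfl⟩
    obtain ⟨n, c, l, hc, rfl⟩ := exists_jordanFrame y
    simp only [hc.mul_sum_sum]
    exact sum_mem_closedCone hc fun i => mul_self_nonneg _
  · intro hx
    obtain ⟨n, c, l, hc, rfl⟩ := exists_jordanFrame x
    rw [sum_mem_closedCone_iff hN hc] at hx
    refine ⟨∑ i, √(l i) • c i, ?_⟩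
    simp only [hc.mul_sum_sum, Real.mul_self_sqrt (hx _)]

theorem isOpen_cone : IsOpen (cone V) := isOpen_interior

/-- Interior points are those with a positive lower bound on the eigenvalues. Frame vectors have
norm `1`, so moving `x` by less than `δ` lowers its pairing with any of them by less than `δ`. -/
theorem mem_cone_iff [FiniteDimensional ℝ V] (hN : IsNormalized V) {x : V} :
    x ∈ cone V ↔ ∃ δ > (0 : ℝ), x - δ • one ∈ closedCone V := by
  rw [cone, range_sq_eq_closedCone hN]
  constructor
  · intro hx
    have hcont : Filter.Tendsto (fun s : ℝ => x - s • (one : V)) (nhds 0) (nhds x) := by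
      have : Continuous fun s : ℝ => x - s • (one : V) := by fun_prop
      simpa using this.tendsto 0
    have h1 := hcont.eventually (mem_interior_iff_mem_nhds.1 hx)
    have h2 := (h1.filter_mono (nhdsWithin_le_nhds (s := Set.Ioi 0))).and self_mem_nhdsWithin
    obtain ⟨δ, h3, h4⟩ := h2.exists
    exact ⟨δ, h4, h3⟩
  · rintro ⟨δ, hδ, hx⟩
    rw [mem_interior_iff_mem_nhds]
    refine Filter.mem_of_superset (Metric.ball_mem_nhds x hδ) fun y hy => ?_
    obtain ⟨n, c, l, hc, rfl⟩ := exists_jordanFrame y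
    rw [sum_mem_closedCone_iff hN hc]
    intro i
    rw [← hc.inner_sum hN l i]
    set y := ∑ j, l j • c j
    have h1 : ⟪y, c i⟫_ℝ = ⟪x - δ • one, c i⟫_ℝ + δ - ⟪x - y, c i⟫_ℝ := by
      rw [inner_sub_left, inner_sub_left, real_inner_smul_left, real_inner_comm (c i) one,
        hc.inner_one hN]
      ring
    have h2 := inner_idempotent_nonneg hx (hc.completeSystem.idem i)
    have h3 := real_inner_le_norm (x - y) (c i)
    rw [hc.norm_eq hN, mul_one, ← dist_eq_norm, dist_comm] at h3
    have h4 := Metric.mem_ball.1 hy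
    linarith

theorem sum_mem_cone_iff [FiniteDimensional ℝ V] (hN : IsNormalized V) {n : ℕ} {c : Fin n → V}
    (h : IsJordanFrame c) {l : Fin n → ℝ} : ∑ i, l i • c i ∈ cone V ↔ ∀ i, 0 < l i := by
  rw [mem_cone_iff hN]
  simp only [sub_smul_one_mem_closedCone_iff hN h]
  constructor
  · rintro ⟨δ, hδ, hl⟩ i
    exact lt_of_lt_of_le hδ (hl i)
  · intro hl
    rcases isEmpty_or_nonempty (Fin n) with hn | hn
    · exact ⟨1, one_pos, fun i => hn.elim i⟩
    · obtain ⟨i, hi⟩ := Finite.exists_min l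
      exact ⟨l i, hl i, hi⟩

theorem cone_subset_closedCone [FiniteDimensional ℝ V] (hN : IsNormalized V) :
    cone V ⊆ closedCone V := by
  rw [← range_sq_eq_closedCone hN]; exact interior_subset

theorem inner_cone_nonneg [FiniteDimensional ℝ V] {x y : V}
    (hx : x ∈ closedCone V) (hy : y ∈ cone V) : 0 ≤ ⟪x, y⟫_ℝ := by
  obtain ⟨z, rfl⟩ := interior_subset hy
  exact hx z

theorem convex_cone [FiniteDimensional ℝ V] (hN : IsNormalized V) : Convex ℝ (cone V) := by
  rw [cone, range_sq_eq_closedCone hN]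
  refine Convex.interior ?_
  intro x hx y hy a b ha hb _
  exact add_mem_closedCone (smul_mem_closedCone ha hx) (smul_mem_closedCone hb hy)

theorem inner_primitive_pos [FiniteDimensional ℝ V] (hN : IsNormalized V) {x c : V}
    (hx : x ∈ cone V) (hc : IsPrimitive c) : 0 < ⟪x, c⟫_ℝ := by
  obtain ⟨δ, hδ, h⟩ := (mem_cone_iff hN).1 hx
  have h1 := inner_idempotent_nonneg h hc.1
  rw [inner_sub_left, real_inner_smul_left, real_inner_comm c one, hc.1.inner_one, hN c hc] at h1
  linarith

end Cone

/-! ### Klein's inequality and `log Δ` -/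

section Determinant

variable {V : Type*} [NormedAddCommGroup V] [InnerProductSpace ℝ V] [EuclideanJordanAlgebra V]

/-- Klein's inequality: `log Δ` lies below its linearization. -/
theorem sum_log_sub_sum_log_le (hN : IsNormalized V) {n m : ℕ} {c : Fin n → V} {d : Fin m → V}
    (hc : IsJordanFrame c) (hd : IsJordanFrame d) {l : Fin n → ℝ} {k : Fin m → ℝ}
    (hl : ∀ i, 0 < l i) (hk : ∀ j, 0 < k j) :
    ∑ j, Real.log (k j) - ∑ i, Real.log (l i) ≤
      ⟪∑ i, (l i)⁻¹ • c i, ∑ j, k j • d j⟫_ℝ - ⟪(one : V), one⟫_ℝ := by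
  -- The matrix `⟪c i, d j⟫` is doubly stochastic, so the claim is an average of `log s ≤ s - 1` at
  -- `s = k j / l i`.
  have hrow : ∀ i, ∑ j, ⟪c i, d j⟫_ℝ = 1 := fun i => by
    rw [← inner_sum, hd.2.2, hc.inner_one hN]
  have hcol : ∀ j, ∑ i, ⟪c i, d j⟫_ℝ = 1 := fun j => by
    rw [← sum_inner, hc.2.2, real_inner_comm, hd.inner_one hN]
  have e1 : ⟪∑ i, (l i)⁻¹ • c i, ∑ j, k j • d j⟫_ℝ =
      ∑ i, ∑ j, ⟪c i, d j⟫_ℝ * (k j / l i) := by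
    rw [sum_inner]
    refine Finset.sum_congr rfl fun i _ => ?_
    rw [inner_sum]
    refine Finset.sum_congr rfl fun j _ => ?_
    rw [real_inner_smul_left, real_inner_smul_right]; ring
  have e2 : ⟪(one : V), one⟫_ℝ = ∑ i, ∑ j, ⟪c i, d j⟫_ℝ := by
    simp only [hrow]
    nth_rewrite 1 [← hc.2.2]
    rw [sum_inner]
    exact Finset.sum_congr rfl fun i _ => hc.inner_one hN i
  have e3 : ∑ i, Real.log (l i) = ∑ i, ∑ j, ⟪c i, d j⟫_ℝ * Real.log (l i) := by
    refine Finset.sum_congr rfl fun i _ => ?_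
    rw [← Finset.sum_mul, hrow, _root_.one_mul]
  have e4 : ∑ j, Real.log (k j) = ∑ i, ∑ j, ⟪c i, d j⟫_ℝ * Real.log (k j) := by
    rw [Finset.sum_comm]
    refine Finset.sum_congr rfl fun j _ => ?_
    rw [← Finset.sum_mul, hcol, _root_.one_mul]
  rw [e1, e2, e3, e4, ← Finset.sum_sub_distrib, ← Finset.sum_sub_distrib]
  refine Finset.sum_le_sum fun i _ => ?_
  rw [← Finset.sum_sub_distrib, ← Finset.sum_sub_distrib]
  refine Finset.sum_le_sum fun j _ => ?_
  have h0 := (hc.completeSystem.idem i).inner_nonneg (hd.completeSystem.idem j)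
  have h1 := Real.log_le_sub_one_of_pos (div_pos (hk j) (hl i))
  rw [Real.log_div (hk j).ne' (hl i).ne'] at h1
  nlinarith [mul_le_mul_of_nonneg_left h1 h0]

theorem IsJordanFrame.mul_inv_sum {n : ℕ} {c : Fin n → V}
    (h : IsJordanFrame c) {l : Fin n → ℝ} (hl : ∀ i, 0 < l i) :
    mul (∑ i, l i • c i) (∑ i, (l i)⁻¹ • c i) = one := by
  rw [h.mul_sum_sum, ← h.2.2]
  exact Finset.sum_congr rfl fun i _ => by rw [mul_inv_cancel₀ (hl i).ne', one_smul]

theorem inner_of_mul_eq_one {x u : V} (h : mul x u = one) : ⟪u, x⟫_ℝ = ⟪(one : V), one⟫_ℝ := by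
  nth_rewrite 1 [← h]
  rw [inner_mul, mul_one']

variable [FiniteDimensional ℝ V]

theorem det_pos (hN : IsNormalized V) {x : V} (hx : x ∈ cone V) : 0 < det x := by
  obtain ⟨n, c, l, hc, rfl, -, hd⟩ := exists_jordanFrame_eigenvalues x
  rw [hd]
  exact Finset.prod_pos fun i _ => (sum_mem_cone_iff hN hc).1 hx i

/-- Independence of the frame chosen in `det`: Klein's inequality is applied both ways between two
decompositions of the same `x`, and its right side vanishes because `⟪x⁻¹, x⟫ = ⟪e, e⟫`. -/
theorem log_det_sum (hN : IsNormalized V) {n : ℕ} {c : Fin n → V} (hc : IsJordanFrame c)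
    {l : Fin n → ℝ} (hl : ∀ i, 0 < l i) :
    Real.log (det (∑ i, l i • c i)) = ∑ i, Real.log (l i) := by
  set x := ∑ i, l i • c i with hx
  obtain ⟨m, d, k, hd, hk, -, hdet⟩ := exists_jordanFrame_eigenvalues x
  have hkpos : ∀ j, 0 < k j := by
    rw [← sum_mem_cone_iff hN hd, ← hk, hx, sum_mem_cone_iff hN hc]; exact hl
  rw [hdet, Real.log_prod fun j _ => (hkpos j).ne']
  have h1 := sum_log_sub_sum_log_le hN hc hd hl hkpos
  have h2 := sum_log_sub_sum_log_le hN hd hc hkpos hl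
  have i1 := inner_of_mul_eq_one (hc.mul_inv_sum hl)
  have i2 := inner_of_mul_eq_one (hd.mul_inv_sum hkpos)
  rw [← hx] at i1 h2
  rw [← hk] at i2 h1
  linarith

/-- The inverse of an element of the cone: it commutes with it, it is the gradient of `log Δ`, and
it is bounded in terms of the least eigenvalue. -/
theorem exists_inverse (hN : IsNormalized V) {x : V} (hx : x ∈ cone V) :
    ∃ u : V, mul x u = one ∧ (∀ z, mul x (mul u z) = mul u (mul x z)) ∧
      (∀ y ∈ cone V, Real.log (det y) - Real.log (det x) ≤ ⟪u, y - x⟫_ℝ) ∧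
      ∀ δ > 0, x - δ • one ∈ closedCone V → ‖u‖ ≤ Module.finrank ℝ V / δ := by
  obtain ⟨n, c, l, hc, rfl⟩ := exists_jordanFrame x
  have hl := (sum_mem_cone_iff hN hc).1 hx
  refine ⟨∑ i, (l i)⁻¹ • c i, hc.mul_inv_sum hl, ?_, ?_, ?_⟩
  · intro z
    simp only [map_sum, map_smul, LinearMap.sum_apply, LinearMap.smul_apply, Finset.smul_sum]
    rw [Finset.sum_comm]
    refine Finset.sum_congr rfl fun i _ => Finset.sum_congr rfl fun j _ => ?_
    rw [smul_comm]
    congr 2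
    by_cases hij : i = j
    · rw [hij]
    · exact (hc.completeSystem.idem i).commute_of_mul_eq_zero (hc.2.1 i j hij) z
  · intro y hy
    obtain ⟨m, d, k, hd, rfl⟩ := exists_jordanFrame y
    have hk := (sum_mem_cone_iff hN hd).1 hy
    rw [log_det_sum hN hc hl, log_det_sum hN hd hk]
    have h := sum_log_sub_sum_log_le hN hc hd hl hk
    rw [inner_sub_right]
    have h2 : ⟪∑ i, (l i)⁻¹ • c i, ∑ i, l i • c i⟫_ℝ = ⟪(one : V), one⟫_ℝ := by
      exact inner_of_mul_eq_one (hc.mul_inv_sum hl)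
    rw [h2]; exact h
  · intro δ hδ hxδ
    have hle := (sub_smul_one_mem_closedCone_iff hN hc).1 hxδ
    calc ‖∑ i, (l i)⁻¹ • c i‖ ≤ ∑ i, ‖(l i)⁻¹ • c i‖ := norm_sum_le _ _
      _ ≤ ∑ i : Fin n, δ⁻¹ := by
        refine Finset.sum_le_sum fun i _ => ?_
        rw [norm_smul, hc.norm_eq hN, mul_one, Real.norm_of_nonneg (inv_nonneg.2 (hl i).le)]
        exact inv_anti₀ hδ (hle i)
      _ = n / δ := by simp [div_eq_mul_inv]
      _ ≤ _ := by
        have := hc.completeSystem.card_le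
        rw [Fintype.card_fin] at this
        gcongr

/-- By `exists_inverse`, `log Δ` has an affine majorant touching it at each point of the cone. -/
theorem concaveOn_log_det (hN : IsNormalized V) :
    ConcaveOn ℝ (cone V) fun x => Real.log (det x) := by
  refine ⟨convex_cone hN, fun x hx y hy a b ha hb hab => ?_⟩
  obtain ⟨u, -, -, hu, -⟩ := exists_inverse hN (convex_cone hN hx hy ha hb hab)
  set z := a • x + b • y with hz
  have h1 := mul_le_mul_of_nonneg_left (hu x hx) ha
  have h2 := mul_le_mul_of_nonneg_left (hu y hy) hb
  have h3 : a * ⟪u, x - z⟫_ℝ + b * ⟪u, y - z⟫_ℝ = 0 := by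
    rw [← real_inner_smul_right, ← real_inner_smul_right, ← inner_add_right]
    have : a • (x - z) + b • (y - z) = 0 := by
      have hb' : b = 1 - a := by linarith
      subst hb'
      rw [hz]; module
    rw [this, inner_zero_right]
  simp only [smul_eq_mul]
  have hb' : b = 1 - a := by linarith
  subst hb'
  nlinarith

theorem continuousOn_log_det (hN : IsNormalized V) :
    ContinuousOn (fun x : V => Real.log (det x)) (cone V) :=
  (concaveOn_log_det hN).continuousOn isOpen_cone

/-- A bounded element of the cone with determinant bounded below stays away from the boundary. -/
theorem sub_smul_one_mem_of_log_det (hN : IsNormalized V) {x : V} (hx : x ∈ cone V) {R κ : ℝ}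
    (hR : 1 ≤ R) (hxR : ‖x‖ ≤ R) (hκ : κ ≤ Real.log (det x)) :
    x - Real.exp (κ - Module.finrank ℝ V * Real.log R) • one ∈ closedCone V := by
  obtain ⟨n, c, l, hc, rfl⟩ := exists_jordanFrame x
  have hl := (sum_mem_cone_iff hN hc).1 hx
  rw [sub_smul_one_mem_closedCone_iff hN hc]
  intro i
  rw [log_det_sum hN hc hl] at hκ
  have hlR : ∀ j, Real.log (l j) ≤ Real.log R := fun j => by
    refine Real.log_le_log (hl j) ?_
    have := real_inner_le_norm (∑ j, l j • c j) (c j)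
    rw [hc.inner_sum hN, hc.norm_eq hN] at this
    linarith
  have hcard := hc.completeSystem.card_le
  rw [Fintype.card_fin] at hcard
  have hlog : 0 ≤ Real.log R := Real.log_nonneg hR
  rw [← Real.le_log_iff_exp_le (hl i)]
  rw [← Finset.add_sum_erase _ _ (Finset.mem_univ i)] at hκ
  -- The other `n - 1` eigenvalues are at most `R`, and `n - 1 ≤ dim V`; hence the exponent in the
  -- bound.
  have h1 : ∑ j ∈ Finset.univ.erase i, Real.log (l j) ≤ Module.finrank ℝ V * Real.log R := by
    calc _ ≤ ∑ j ∈ Finset.univ.erase i, Real.log R := Finset.sum_le_sum fun j _ => hlR j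
      _ = (n - 1 : ℕ) * Real.log R := by simp [Finset.card_erase_of_mem]
      _ ≤ _ := by
        gcongr
        omega
  linarith

end Determinant
-- The Peirce `1`-space as a smaller Jordan algebra
section PeirceOne

variable {V : Type*} [NormedAddCommGroup V] [InnerProductSpace ℝ V] [EuclideanJordanAlgebra V]

/-- The Peirce `1`-space of an idempotent. -/
def peirceOne (k : {k : V // IsIdempotent k}) : Submodule ℝ V where
  carrier := {y | mul (k : V) y = y}
  add_mem' {a b} ha hb := by
    simp only [Set.mem_ofPred_eq] at *
    rw [map_add, ha, hb]
  zero_mem' := by simp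
  smul_mem' r a ha := by
    simp only [Set.mem_ofPred_eq] at *
    rw [map_smul, ha]

theorem mem_peirceOne {k : {k : V // IsIdempotent k}} {y : V} :
    y ∈ peirceOne k ↔ mul (k : V) y = y := Iff.rfl

theorem mul_mem_peirceOne (k : {k : V // IsIdempotent k}) {x y : V} (hx : x ∈ peirceOne k)
    (hy : y ∈ peirceOne k) : mul x y ∈ peirceOne k := by
  rw [mem_peirceOne] at *
  rw [k.2.commute_of_eigen (μ := 1) (by norm_num) (by rw [hx, one_smul]), hy]

/-- The Peirce `1`-space is a Euclidean Jordan algebra. -/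
instance (k : {k : V // IsIdempotent k}) : EuclideanJordanAlgebra (peirceOne k) where
  mul := LinearMap.mk₂ ℝ (fun x y => ⟨mul (x : V) (y : V), mul_mem_peirceOne k x.2 y.2⟩)
    (fun _ _ _ => Subtype.ext (by simp)) (fun _ _ _ => Subtype.ext (by simp))
    (fun _ _ _ => Subtype.ext (by simp)) (fun _ _ _ => Subtype.ext (by simp))
  one := ⟨k, k.2⟩
  mul_comm x y := Subtype.ext (mul_comm (x : V) y)
  one_mul x := Subtype.ext x.2
  jordan x y := Subtype.ext (jordan (x : V) y)
  inner_mul x y z := inner_mul (x : V) y z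

theorem coe_one_peirceOne {k : {k : V // IsIdempotent k}} :
    ((one : peirceOne k) : V) = k := rfl

theorem IsIdempotent.coe_peirceOne {k : {k : V // IsIdempotent k}} {a : peirceOne k}
    (ha : IsIdempotent a) : IsIdempotent (a : V) :=
  congrArg Subtype.val ha

/-- Any idempotent summand of `a` in `V` is orthogonal to `e - k`, hence already lies in the Peirce
space, so nothing new can split `a`. -/
theorem IsPrimitive.coe_peirceOne {k : {k : V // IsIdempotent k}} {a : peirceOne k}
    (ha : IsPrimitive a) : IsPrimitive (a : V) := by
  have ha1 := ha.1.coe_peirceOne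
  have hsub : ∀ p q : V, IsIdempotent p → IsIdempotent q → p + q = a → p ∈ peirceOne k := by
    intro p q hp hq hs
    have hk1 : IsIdempotent ((one : V) - k) := isIdempotent_one.sub k.2 (one_mul _)
    have h1 : mul p ((one : V) - k) = 0 := by
      refine hp.mul_eq_zero_of_add hq hk1 ?_
      rw [hs, map_sub, mul_one', mul_comm, mem_peirceOne.1 a.2, sub_self]
    rw [map_sub, mul_one', sub_eq_zero] at h1
    rw [mem_peirceOne, mul_comm]; exact h1.symm
  refine ⟨ha1, fun h => ha.2.1 (Subtype.ext h), fun p q hp hq hpq hs => ?_⟩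
  have hp' := hsub p q hp hq hs
  have hq' := hsub q p hq hp (by rw [add_comm, hs])
  have := ha.2.2 ⟨p, hp'⟩ ⟨q, hq'⟩ (Subtype.ext hp) (Subtype.ext hq) (Subtype.ext hpq)
    (Subtype.ext hs)
  exact this.imp (congrArg Subtype.val) (congrArg Subtype.val)

theorem IsNormalized.peirceOne (hN : IsNormalized V) (k : {k : V // IsIdempotent k}) :
    IsNormalized (peirceOne k) := fun _ hc => hN _ hc.coe_peirceOne

/-- Every member of a Jordan frame of `V₁(c)` is a nonzero idempotent below `c`, hence equal to `c`.
-/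
theorem IsPrimitive.eq_smul [FiniteDimensional ℝ V] (hN : IsNormalized V) {c y : V}
    (hc : IsPrimitive c) (hy : mul c y = y) : y = ⟪y, c⟫_ℝ • c := by
  have hyk : y ∈ EuclideanJordanAlgebra.peirceOne ⟨c, hc.1⟩ := hy
  obtain ⟨n, d, l, hd, hx⟩ := exists_jordanFrame
    (⟨y, hyk⟩ : EuclideanJordanAlgebra.peirceOne ⟨c, hc.1⟩)
  have hdc : ∀ i, (d i : V) = c := by
    intro i
    have hi := (hd.1 i).coe_peirceOne
    have hm : mul c (d i : V) = d i := (d i).2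
    have h0 := (hc.2.2 (d i) (c - d i) hi.1 (hc.1.sub hi.1 hm)
      (by rw [map_sub, mul_comm, hm, show mul (d i : V) (d i) = d i from hi.1, sub_self])
      (by abel)).resolve_left hi.2.1
    exact (sub_eq_zero.1 h0).symm
  have hy2 : y = (∑ i, l i) • c := by
    have := congrArg Subtype.val hx
    simp only [Submodule.coe_sum, Submodule.coe_smul, hdc] at this
    rw [Finset.sum_smul]; exact this
  rw [hy2, real_inner_smul_left, hN c hc, _root_.mul_one]

/-- The complementary idempotent. -/
def IsIdempotent.compl {c : V} (hc : IsIdempotent c) : {k : V // IsIdempotent k} :=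
  ⟨one - c, isIdempotent_one.sub hc (one_mul _)⟩

theorem IsIdempotent.coe_compl {c : V} (hc : IsIdempotent c) : (hc.compl : V) = one - c := rfl

theorem IsIdempotent.mem_peirceOne_compl {c y : V} (hc : IsIdempotent c) :
    y ∈ peirceOne hc.compl ↔ mul c y = 0 := by
  rw [mem_peirceOne, IsIdempotent.compl, map_sub, LinearMap.sub_apply, one_mul, sub_eq_self]

/-- The cone and the determinant on `ℝ c ⊕ V₀(c)`. -/
theorem IsPrimitive.smul_add_mem_cone [FiniteDimensional ℝ V] (hN : IsNormalized V) {c : V}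
    (hc : IsPrimitive c) {t : ℝ} {w : peirceOne hc.1.compl} (h : t • c + (w : V) ∈ cone V) :
    0 < t ∧ w ∈ cone (peirceOne hc.1.compl) ∧
      Real.log (det (t • c + (w : V))) = Real.log t + Real.log (det w) := by
  have hN' := hN.peirceOne hc.1.compl
  obtain ⟨n, d, l, hd, rfl⟩ := exists_jordanFrame w
  have hcd : ∀ i, mul c (d i : V) = 0 := fun i => hc.1.mem_peirceOne_compl.1 (d i).2
  have hf : IsJordanFrame (Fin.cons c fun i => (d i : V) : Fin (n + 1) → V) := by
    refine ⟨?_, ?_, ?_⟩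
    · refine Fin.cases hc fun i => ?_
      rw [Fin.cons_succ]; exact (hd.1 i).coe_peirceOne
    · refine Fin.cases (Fin.cases ?_ ?_) fun i => Fin.cases ?_ ?_
      · exact fun h => absurd rfl h
      · intro i _
        rw [Fin.cons_zero, Fin.cons_succ, hcd]
      · intro _
        rw [Fin.cons_zero, Fin.cons_succ, mul_comm, hcd]
      · intro j hij
        rw [Fin.cons_succ, Fin.cons_succ]
        exact congrArg Subtype.val (hd.2.1 i j fun h => hij (by rw [h]))
    · rw [Fin.sum_univ_succ]
      simp only [Fin.cons_zero, Fin.cons_succ]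
      have := congrArg Subtype.val hd.2.2
      rw [Submodule.coe_sum, coe_one_peirceOne] at this
      rw [this, IsIdempotent.compl]; simp
  have hx : t • c + ((∑ i, l i • d i : peirceOne hc.1.compl) : V) =
      ∑ i, (Fin.cons t l : Fin (n + 1) → ℝ) i •
        (Fin.cons c fun i => (d i : V) : Fin (n + 1) → V) i := by
    rw [Fin.sum_univ_succ]
    simp
  rw [hx] at h
  have hpos := (sum_mem_cone_iff hN hf).1 h
  have ht := hpos 0
  have hl : ∀ i, 0 < l i := fun i => by simpa using hpos i.succ
  refine ⟨by simpa using ht, (sum_mem_cone_iff hN' hd).2 hl, ?_⟩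
  rw [hx, log_det_sum hN hf hpos, log_det_sum hN' hd hl, Fin.sum_univ_succ]
  simp

end PeirceOne

/-! ### Determinant-preserving quadratic flows -/

section Flow

variable {V : Type*} [NormedAddCommGroup V] [InnerProductSpace ℝ V]

/-- The quadratic curve `exp (s X) x` for `X ^ 3 x = 0`. -/
def quadCurve (X : V →ₗ[ℝ] V) (x : V) (s : ℝ) : V := x + s • X x + (s ^ 2 / 2) • X (X x)

theorem continuous_quadCurve (X : V →ₗ[ℝ] V) (x : V) : Continuous (quadCurve X x) := by
  unfold quadCurve; fun_prop

theorem quadCurve_sub {X : V →ₗ[ℝ] V} {x : V} (hX3 : X (X (X x)) = 0) (s t : ℝ) :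
    quadCurve X x t - quadCurve X x s =
      (t - s) • X (quadCurve X x s) + ((t - s) ^ 2 / 2) • X (X x) := by
  simp only [quadCurve, map_add, map_smul, hX3]
  module

variable [EuclideanJordanAlgebra V]

/-- `X` infinitesimally preserves the determinant. -/
def IsInfinitesimallyDetPreserving (X : V →ₗ[ℝ] V) : Prop :=
  ∀ x u : V, mul x u = one → (∀ z, mul x (mul u z) = mul u (mul x z)) → ⟪u, X x⟫_ℝ = 0

variable [FiniteDimensional ℝ V]

/-- Klein's inequality based at either of two nearby points bounds the increment of `log Δ` from
both sides. The first-order term vanishes by `hX`, leaving an error quadratic in the parameter. -/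
theorem hasDerivAt_log_det_quadCurve (hN : IsNormalized V) {X : V →ₗ[ℝ] V}
    (hX : IsInfinitesimallyDetPreserving X) {x : V} (hX3 : X (X (X x)) = 0) {s : ℝ}
    (hs : quadCurve X x s ∈ cone V) :
    HasDerivAt (fun s => Real.log (det (quadCurve X x s))) 0 s := by
  obtain ⟨δ, hδ, hδs⟩ := (mem_cone_iff hN).1 hs
  have hcont := continuous_quadCurve X x
  -- Half of the margin `δ` persists near `s`, which bounds the inverses uniformly.
  have hmem : ∀ᶠ t in nhds s, quadCurve X x t - (δ / 2) • one ∈ cone V := by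
    have h0 : quadCurve X x s - (δ / 2) • one ∈ cone V := by
      refine (mem_cone_iff hN).2 ⟨δ / 2, half_pos hδ, ?_⟩
      convert hδs using 1
      module
    have : Continuous fun t => quadCurve X x t - (δ / 2) • (one : V) := by fun_prop
    exact this.continuousAt.eventually (isOpen_cone.mem_nhds h0)
  set C : ℝ := Module.finrank ℝ V / (δ / 2) * ‖X (X x)‖ with hC
  have hC0 : 0 ≤ C := by positivity
  have key : ∀ a b, quadCurve X x a - (δ / 2) • one ∈ cone V →
      quadCurve X x b - (δ / 2) • one ∈ cone V →
      Real.log (det (quadCurve X x b)) - Real.log (det (quadCurve X x a)) ≤ C * (b - a) ^ 2 := by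
    intro a b ha hb
    have hcone : ∀ y : V, y - (δ / 2) • one ∈ cone V → y ∈ cone V := fun y hy =>
      (mem_cone_iff hN).2 ⟨δ / 2, half_pos hδ, cone_subset_closedCone hN hy⟩
    obtain ⟨u, hu1, hu2, hu3, hu4⟩ := exists_inverse hN (hcone _ ha)
    have h1 := hu3 _ (hcone _ hb)
    rw [quadCurve_sub hX3, inner_add_right, real_inner_smul_right, hX _ _ hu1 hu2,
      mul_zero, zero_add, real_inner_smul_right] at h1
    have h2 := hu4 _ (half_pos hδ) (cone_subset_closedCone hN ha)
    have h3 : ⟪u, X (X x)⟫_ℝ ≤ C := (real_inner_le_norm _ _).trans (by rw [hC]; gcongr)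
    nlinarith [mul_le_mul_of_nonneg_left h3 (sq_nonneg (b - a)), mul_nonneg hC0 (sq_nonneg (b - a))]
  rw [hasDerivAt_iff_isLittleO]
  have hO : (fun t => Real.log (det (quadCurve X x t)) - Real.log (det (quadCurve X x s)) -
      (t - s) • (0 : ℝ)) =O[nhds s] fun t => (t - s) ^ 2 := by
    refine Asymptotics.IsBigO.of_bound C ?_
    filter_upwards [hmem] with t ht
    have h1 := key s t hmem.self_of_nhds ht
    have h2 := key t s ht hmem.self_of_nhds
    rw [smul_zero, sub_zero, Real.norm_eq_abs, Real.norm_of_nonneg (sq_nonneg _), abs_le]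
    constructor <;> nlinarith
  refine hO.trans_isLittleO ?_
  simpa only [Real.norm_eq_abs, sq_abs] using Asymptotics.isLittleO_pow_sub_sub s one_lt_two

/-- The curve cannot leave the cone: while `log Δ` stays equal to `κ`, boundedness keeps the curve
away from the boundary, so the good parameters form a closed set; the zero derivative extends this
set to the right. -/
theorem quadCurve_one_mem_cone (hN : IsNormalized V) {X : V →ₗ[ℝ] V}
    (hX : IsInfinitesimallyDetPreserving X) {x : V} (hx : x ∈ cone V) (hX3 : X (X (X x)) = 0) :
    quadCurve X x 1 ∈ cone V ∧ Real.log (det (quadCurve X x 1)) = Real.log (det x) := by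
  have hcont := continuous_quadCurve X x
  obtain ⟨R, hR1, hR⟩ : ∃ R : ℝ, 1 ≤ R ∧ ∀ s ∈ Set.Icc (0 : ℝ) 1, ‖quadCurve X x s‖ ≤ R := by
    obtain ⟨R, hR⟩ := isCompact_Icc.exists_bound_of_continuousOn (hcont.continuousOn (s := Set.Icc 0 1))
    exact ⟨max 1 R, le_max_left _ _, fun s hs => (hR s hs).trans (le_max_right _ _)⟩
  set κ := Real.log (det x) with hκ
  set δ := Real.exp (κ - Module.finrank ℝ V * Real.log R) with hδ
  have hδ0 : 0 < δ := Real.exp_pos _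
  let S : Set ℝ := {s | quadCurve X x s ∈ cone V ∧ Real.log (det (quadCurve X x s)) = κ}
  have h0 : quadCurve X x 0 = x := by simp [quadCurve]
  have hclosed : IsClosed (S ∩ Set.Icc 0 1) := by
    have hB : IsClosed {s : ℝ | s ∈ Set.Icc (0 : ℝ) 1 ∧
        quadCurve X x s - δ • one ∈ closedCone V} := by
      refine isClosed_Icc.inter (isClosed_closedCone.preimage ?_)
      fun_prop
    have hcontB : ContinuousOn (fun s => Real.log (det (quadCurve X x s)))
        {s : ℝ | s ∈ Set.Icc (0 : ℝ) 1 ∧ quadCurve X x s - δ • one ∈ closedCone V} :=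
      (continuousOn_log_det hN).comp hcont.continuousOn fun s hs =>
        (mem_cone_iff hN).2 ⟨δ, hδ0, hs.2⟩
    have := hcontB.preimage_isClosed_of_isClosed hB (isClosed_singleton (x := κ))
    convert this using 1
    ext s
    constructor
    · rintro ⟨⟨h1, h2⟩, h3⟩
      exact ⟨⟨h3, sub_smul_one_mem_of_log_det hN h1 hR1 (hR s h3) h2.ge⟩, h2⟩
    · rintro ⟨⟨h1, h2⟩, h3⟩
      exact ⟨⟨(mem_cone_iff hN).2 ⟨δ, hδ0, h2⟩, h3⟩, h1⟩
  have hsub : Set.Icc (0 : ℝ) 1 ⊆ S := by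
    refine hclosed.Icc_subset_of_forall_exists_gt ⟨by rw [h0]; exact hx, by rw [h0]⟩ ?_
    rintro s ⟨⟨hs1, hs2⟩, hs3⟩ y hy
    have hopen := hcont.continuousAt.eventually (isOpen_cone.mem_nhds hs1)
    obtain ⟨η, hη, hball⟩ := Metric.eventually_nhds_iff.1 hopen
    set b := min y (s + η / 2) with hb
    have hsb : s < b := lt_min hy (by linarith)
    have hin : ∀ t ∈ Set.Icc s b, quadCurve X x t ∈ cone V := by
      intro t ht
      refine hball ?_
      have := ht.2.trans (min_le_right y (s + η / 2))
      rw [Real.dist_eq, abs_of_nonneg (by linarith [ht.1])]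
      linarith
    have hconst := constant_of_has_deriv_right_zero (a := s) (b := b)
      (f := fun s => Real.log (det (quadCurve X x s)))
      (fun t ht => (hasDerivAt_log_det_quadCurve hN hX hX3 (hin t ht)).continuousAt.continuousWithinAt)
      (fun t ht => (hasDerivAt_log_det_quadCurve hN hX hX3
        (hin t (Set.Ico_subset_Icc_self ht))).hasDerivWithinAt) b (Set.right_mem_Icc.2 hsb.le)
    exact ⟨b, ⟨hin b (Set.right_mem_Icc.2 hsb.le), hconst.trans hs2⟩, hsb, min_le_left _ _⟩
  exact hsub (Set.right_mem_Icc.2 zero_le_one)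

end Flow

/-! ### Frobenius transformations and completing the square -/

section Frobenius

variable {V : Type*} [NormedAddCommGroup V] [InnerProductSpace ℝ V] [EuclideanJordanAlgebra V]

/-- The generator of a Frobenius transformation. -/
def frobenius (c z : V) : V →ₗ[ℝ] V :=
  mul z + (2 : ℝ) • (mul z ∘ₗ mul c - mul c ∘ₗ mul z)

theorem frobenius_apply (c z y : V) :
    frobenius c z y = mul z y + (2 : ℝ) • (mul z (mul c y) - mul c (mul z y)) := by
  simp [frobenius]

theorem IsIdempotent.inner_half_one {c z : V} (hc : IsIdempotent c)
    (hz : mul c z = (1 / 2 : ℝ) • z) : ⟪z, one⟫_ℝ = 0 := by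
  have h1 : ⟪z, c⟫_ℝ = (1 / 2) * ⟪z, c⟫_ℝ := by
    nth_rewrite 1 [← show mul c c = c from hc]
    rw [inner_mul_right, hz, real_inner_smul_left]
  have h2 : ⟪mul c z, one⟫_ℝ = ⟪z, c⟫_ℝ := by rw [inner_mul, mul_one']
  rw [hz, real_inner_smul_left] at h2
  linarith

/-- Associativity of the inner product moves everything onto `z`: the first term becomes `⟪z, e⟫ =
0`, and the other two cancel because multiplications by `x` and `u` commute. -/
theorem IsIdempotent.frobenius_detPreserving {c z : V} (hc : IsIdempotent c)
    (hz : mul c z = (1 / 2 : ℝ) • z) : IsInfinitesimallyDetPreserving (frobenius c z) := by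
  intro x u hxu hcomm
  have e1 : ⟪u, mul z x⟫_ℝ = ⟪z, one⟫_ℝ := by
    rw [mul_comm, inner_mul_right, hxu, real_inner_comm]
  have e2 : ⟪u, mul z (mul c x)⟫_ℝ = ⟪z, mul u (mul x c)⟫_ℝ := by
    rw [inner_mul_right, mul_comm z u, inner_mul, mul_comm c x]
  have e3 : ⟪u, mul c (mul z x)⟫_ℝ = ⟪z, mul x (mul u c)⟫_ℝ := by
    rw [inner_mul_right, mul_comm z x, inner_mul_right, real_inner_comm, mul_comm c u]
  rw [frobenius_apply, inner_add_right, real_inner_smul_right, inner_sub_right, e1, e2, e3,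
    hcomm, hc.inner_half_one hz]
  ring

theorem IsIdempotent.frobenius_zero_space {c z v : V} (hc : IsIdempotent c)
    (hz : mul c z = (1 / 2 : ℝ) • z) (hv : mul c v = 0) : frobenius c z v = 0 := by
  have h := hc.commute_of_eigen (μ := 0) (by norm_num) (by rw [hv, zero_smul]) z
  rw [hz, map_smul, mul_comm v z] at h
  rw [frobenius_apply, hv, h, map_zero]
  module

/-- The component in `V₀(c)` of the square of an element of `V_{1/2}(c)`. -/
def halfSquare (c u : V) : V := mul u u - mul c (mul u u)

theorem IsIdempotent.mul_halfSquare {c u : V} (hc : IsIdempotent c)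
    (hu : mul c u = (1 / 2 : ℝ) • u) : mul c (halfSquare c u) = 0 := by
  rw [halfSquare, map_sub, hc.half_mul_half hu hu, sub_self]

theorem IsIdempotent.inner_halfSquare {c u : V}
    (hu : mul c u = (1 / 2 : ℝ) • u) : ⟪halfSquare c u, one⟫_ℝ = ‖u‖ ^ 2 / 2 := by
  have h1 : ⟪mul c (mul u u), one⟫_ℝ = (1 / 2) * ⟪u, u⟫_ℝ := by
    rw [inner_mul, mul_one', inner_mul, mul_comm u c, hu, real_inner_smul_right]
  rw [halfSquare, inner_sub_left, h1, inner_mul, mul_one', real_inner_self_eq_norm_sq]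
  ring

/-- Completing the square: the determinant of `t c + u + v` is that of `t c + (v - u² / t)`. -/
theorem IsPrimitive.complete_square [FiniteDimensional ℝ V] (hN : IsNormalized V) {c : V}
    (hc : IsPrimitive c) {t : ℝ} {u v : V} (hu : mul c u = (1 / 2 : ℝ) • u) (hv : mul c v = 0)
    (h : t • c + u + v ∈ cone V) :
    0 < t ∧ t • c + (v - t⁻¹ • halfSquare c u) ∈ cone V ∧
      Real.log (det (t • c + (v - t⁻¹ • halfSquare c u))) = Real.log (det (t • c + u + v)) := by
  have hcc : mul c c = c := hc.1
  have huc : ⟪u, c⟫_ℝ = 0 := by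
    have h1 : ⟪mul c u, c⟫_ℝ = ⟪u, c⟫_ℝ := by rw [inner_mul, hcc]
    rw [hu, real_inner_smul_left] at h1
    linarith
  have hvc : ⟪v, c⟫_ℝ = 0 := by
    have h1 : ⟪mul c v, c⟫_ℝ = ⟪v, c⟫_ℝ := by rw [inner_mul, hcc]
    rw [← h1, hv, inner_zero_left]
  have ht : 0 < t := by
    have := inner_primitive_pos hN h hc
    rwa [inner_add_left, inner_add_left, huc, hvc, real_inner_smul_left, hN c hc, _root_.mul_one,
      add_zero, add_zero] at this
  -- The generator sends `c` to `z`, `u` into `V₀(c)` and `V₀(c)` to `0`, so its cube kills the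
  -- starting point. This `z` makes the `1/2`-component vanish at time `1`.
  set z : V := -(t⁻¹ • u) with hz
  have hcz : mul c z = (1 / 2 : ℝ) • z := by
    rw [hz, map_neg, map_smul, hu]; module
  set q := halfSquare c u with hq
  have hXc : frobenius c z c = z := by
    rw [frobenius_apply, hcc, mul_comm z c, hcz, map_smul, hcz]; module
  have hXu : frobenius c z u = -((2 * t⁻¹) • q) := by
    rw [frobenius_apply, hu, hq, halfSquare, hz]
    simp only [map_neg, map_smul, LinearMap.neg_apply, LinearMap.smul_apply]
    module
  have hXv : frobenius c z v = 0 := hc.1.frobenius_zero_space hcz hv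
  have hXq : frobenius c z q = 0 := hc.1.frobenius_zero_space hcz (hc.1.mul_halfSquare hu)
  have hX1 : frobenius c z (t • c + u + v) = -u - (2 * t⁻¹) • q := by
    rw [map_add, map_add, map_smul, hXc, hXu, hXv, hz, smul_neg, smul_smul,
      mul_inv_cancel₀ ht.ne']
    module
  have hX2 : frobenius c z (frobenius c z (t • c + u + v)) = (2 * t⁻¹) • q := by
    rw [hX1, map_sub, map_neg, hXu, map_smul, hXq]; module
  have hX3 : frobenius c z (frobenius c z (frobenius c z (t • c + u + v))) = 0 := by
    rw [hX2, map_smul, hXq, smul_zero]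
  have hend : quadCurve (frobenius c z) (t • c + u + v) 1 = t • c + (v - t⁻¹ • q) := by
    rw [quadCurve, hX2, hX1]; module
  have := quadCurve_one_mem_cone hN (hc.1.frobenius_detPreserving hcz) h hX3
  rw [hend] at this
  exact ⟨ht, this⟩

end Frobenius
-- Peirce coordinates
section Decomposition

variable {V : Type*} [NormedAddCommGroup V] [InnerProductSpace ℝ V] [EuclideanJordanAlgebra V]

/-- The Peirce `1/2`-space. -/
abbrev peirceHalf (c : V) : Submodule ℝ V := Module.End.eigenspace (mul c : Module.End ℝ V) (1 / 2)

theorem mem_peirceHalf {c u : V} : u ∈ peirceHalf c ↔ mul c u = (1 / 2 : ℝ) • u :=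
  Module.End.mem_eigenspace_iff

/-- The map `(t, u, v) ↦ t c + u + v` of the Peirce decomposition. -/
def peirceMap {c : V} (hc : IsPrimitive c) :
    (ℝ × peirceHalf c × peirceOne hc.1.compl) →ₗ[ℝ] V :=
  (LinearMap.toSpanSingleton ℝ V c).coprod
    ((peirceHalf c).subtype.coprod (peirceOne hc.1.compl).subtype)

theorem peirceMap_apply {c : V} (hc : IsPrimitive c) (t : ℝ) (u : peirceHalf c)
    (v : peirceOne hc.1.compl) : peirceMap hc (t, u, v) = t • c + u + v := by
  simp [peirceMap, add_assoc]

theorem bijective_peirceMap [FiniteDimensional ℝ V] (hN : IsNormalized V) {c : V} (hc : IsPrimitive c) :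
    Function.Bijective (peirceMap hc) := by
  have hcc : mul c c = c := hc.1
  constructor
  · rw [← LinearMap.ker_eq_bot, LinearMap.ker_eq_bot']
    rintro ⟨t, u, v⟩ h
    rw [peirceMap_apply] at h
    have hu := mem_peirceHalf.1 u.2
    have hv := hc.1.mem_peirceOne_compl.1 v.2
    have h1 := congrArg (mul c) h
    simp only [map_add, map_smul, hcc, hu, hv, map_zero] at h1
    have h2 := congrArg (mul c) h1
    simp only [map_add, map_smul, hcc, hu, map_zero] at h2
    have h3 : (t / 2) • c = 0 := by
      linear_combination (norm := module) h2 - (1 / 2 : ℝ) • h1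
    have ht : t = 0 := by
      have := (smul_eq_zero.1 h3).resolve_right hc.2.1
      linarith
    subst ht
    have hu0 : (u : V) = 0 := by
      linear_combination (norm := module) (2 : ℝ) • h1
    have hv0 : (v : V) = 0 := by
      rw [hu0] at h
      linear_combination (norm := module) h
    rw [Prod.mk_eq_zero, Prod.mk_eq_zero]
    exact ⟨rfl, Subtype.ext hu0, Subtype.ext hv0⟩
  · intro x
    -- The components of `x` are given by the projections `2L² - L`, `4L - 4L²` and `1 - 3L + 2L²`,
    -- polynomials in the multiplication `L` by `c`.
    have h3 := hc.1.peirce_cubic x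
    have h4 : mul c (mul c (mul c x)) =
        (3 / 2 : ℝ) • mul c (mul c x) - (1 / 2 : ℝ) • mul c x := by
      linear_combination (norm := module) (1 / 2 : ℝ) • h3
    have hu : (4 : ℝ) • mul c x - (4 : ℝ) • mul c (mul c x) ∈ peirceHalf c := by
      rw [mem_peirceHalf, map_sub, map_smul, map_smul, h4]; module
    have hv : x - (3 : ℝ) • mul c x + (2 : ℝ) • mul c (mul c x) ∈ peirceOne hc.1.compl := by
      rw [hc.1.mem_peirceOne_compl, map_add, map_sub, map_smul, map_smul, h4]; module
    have h1 := hc.eq_smul hN (y := (2 : ℝ) • mul c (mul c x) - mul c x) (by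
      rw [map_sub, map_smul, h4]; module)
    refine ⟨(⟪(2 : ℝ) • mul c (mul c x) - mul c x, c⟫_ℝ, ⟨_, hu⟩, ⟨_, hv⟩), ?_⟩
    rw [peirceMap_apply, ← h1]
    module

theorem continuous_mul_self [FiniteDimensional ℝ V] : Continuous fun x : V => mul x x := by
  let b := stdOrthonormalBasis ℝ V
  have h : (fun x : V => mul x x) = fun x => ∑ i, ⟪b i, x⟫_ℝ • mul (b i) x := by
    funext x
    conv_lhs => rw [← b.sum_repr' x]
    rw [map_sum (mul : V →ₗ[ℝ] V →ₗ[ℝ] V), LinearMap.sum_apply, b.sum_repr' x]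
    simp only [map_smul, LinearMap.smul_apply]
  rw [h]
  refine continuous_finsetSum _ fun i _ => ?_
  exact (by fun_prop : Continuous fun x => ⟪b i, x⟫_ℝ).smul
    (LinearMap.continuous_of_finiteDimensional (mul (b i)))

theorem continuous_halfSquare [FiniteDimensional ℝ V] (c : V) : Continuous (halfSquare c) :=
  continuous_mul_self.sub
    ((LinearMap.continuous_of_finiteDimensional (mul c)).comp continuous_mul_self)

end Decomposition

/-! ### Convergence of the gamma integral -/

section Integral

/-- The integrand of the gamma integral, as a function on `V`. -/
def gammaIntegrand (V : Type*) [NormedAddCommGroup V] [InnerProductSpace ℝ V]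
    [EuclideanJordanAlgebra V] (ε p : ℝ) : V → ℝ≥0∞ :=
  (cone V).indicator fun x =>
    ENNReal.ofReal (Real.exp (-(ε * ⟪x, one⟫_ℝ) + p * Real.log (det x)))

theorem measurable_gammaIntegrand {V : Type*} [NormedAddCommGroup V] [InnerProductSpace ℝ V]
    [FiniteDimensional ℝ V] [MeasurableSpace V] [BorelSpace V] [EuclideanJordanAlgebra V]
    (hN : IsNormalized V) (ε p : ℝ) : Measurable (gammaIntegrand V ε p) := by
  classical
  rw [gammaIntegrand, ← Set.piecewise_eq_indicator]
  refine ContinuousOn.measurable_piecewise ?_ continuousOn_const isOpen_cone.measurableSet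
  refine ENNReal.continuous_ofReal.comp_continuousOn
    (Real.continuous_exp.comp_continuousOn (ContinuousOn.add ?_ ?_))
  · exact Continuous.continuousOn (by fun_prop)
  · exact continuousOn_const.mul (continuousOn_log_det hN)

theorem lintegral_exp_neg_norm_lt_top {U : Type*} [NormedAddCommGroup U] [InnerProductSpace ℝ U]
    [FiniteDimensional ℝ U] [MeasurableSpace U] [BorelSpace U] {ε : ℝ} (hε : 0 < ε) :
    ∫⁻ u : U, ENNReal.ofReal (Real.exp (-(ε * ‖u‖))) < ∞ := by
  set k := Module.finrank ℝ U + 1 with hk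
  set C : ℝ := Real.exp ε * k.factorial / ε ^ k with hC
  have hC0 : 0 ≤ C := by positivity
  have hle : ∀ u : U, ENNReal.ofReal (Real.exp (-(ε * ‖u‖))) ≤
      ENNReal.ofReal C * ENNReal.ofReal ((1 + ‖u‖) ^ (-(k : ℝ))) := by
    intro u
    rw [← ENNReal.ofReal_mul hC0]
    refine ENNReal.ofReal_le_ofReal ?_
    have h0 : 0 < 1 + ‖u‖ := by positivity
    have h1 := Real.pow_div_factorial_le_exp (ε * (1 + ‖u‖)) (by positivity) k
    rw [Real.rpow_neg h0.le, Real.rpow_natCast, ← div_eq_mul_inv, le_div_iff₀ (by positivity), hC,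
      le_div_iff₀ (by positivity), Real.exp_neg]
    rw [div_le_iff₀ (by positivity), mul_pow, mul_add, _root_.mul_one, Real.exp_add] at h1
    rw [mul_assoc, inv_mul_le_iff₀ (Real.exp_pos _)]
    nlinarith
  refine (lintegral_mono hle).trans_lt ?_
  rw [lintegral_const_mul' _ _ ENNReal.ofReal_ne_top]
  refine ENNReal.mul_lt_top ENNReal.ofReal_lt_top (finite_integral_one_add_norm ?_)
  rw [hk]; push_cast; linarith

theorem lintegral_rpow_exp_lt_top {ε p : ℝ} (hε : 0 < ε) (hp : -1 < p) :
    ∫⁻ t : ℝ, (Set.Ioi (0 : ℝ)).indicator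
      (fun t => ENNReal.ofReal (t ^ p * Real.exp (-ε * t))) t < ∞ := by
  rw [lintegral_indicator measurableSet_Ioi]
  have h := integrableOn_rpow_mul_exp_neg_mul_rpow hp one_pos hε
  simp only [Real.rpow_one] at h
  exact h.lintegral_lt_top

/-- The gamma integrand is bounded by a product in the Peirce coordinates. -/
theorem gammaIntegrand_peirceMap_le {V : Type*} [NormedAddCommGroup V] [InnerProductSpace ℝ V]
    [FiniteDimensional ℝ V] [EuclideanJordanAlgebra V] (hN : IsNormalized V) {c : V}
    (hc : IsPrimitive c) {ε : ℝ} (hε : 0 < ε) (p t : ℝ) (u : peirceHalf c)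
    (v : peirceOne hc.1.compl) :
    gammaIntegrand V ε p (peirceMap hc (t, u, v)) ≤
      (Set.Ioi (0 : ℝ)).indicator
        (fun t => ENNReal.ofReal (t ^ p * Real.exp (-(ε / 2) * t))) t *
      (ENNReal.ofReal (Real.exp (-(ε * ‖u‖))) *
        gammaIntegrand (peirceOne hc.1.compl) ε p (v - t⁻¹ •
          ⟨halfSquare c u, hc.1.mem_peirceOne_compl.2
            (hc.1.mul_halfSquare (mem_peirceHalf.1 u.2))⟩)) := by
  have hu := mem_peirceHalf.1 u.2
  have hv := hc.1.mem_peirceOne_compl.1 v.2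
  set q : peirceOne hc.1.compl := ⟨halfSquare c u, hc.1.mem_peirceOne_compl.2
            (hc.1.mul_halfSquare hu)⟩ with hq
  rw [peirceMap_apply]
  by_cases hx : t • c + (u : V) + v ∈ cone V
  swap
  · rw [gammaIntegrand, Set.indicator_of_notMem hx]; exact zero_le
  obtain ⟨ht, h1, h2⟩ := hc.complete_square hN hu hv hx
  have hw : (v : V) - t⁻¹ • halfSquare c u = ((v - t⁻¹ • q : peirceOne hc.1.compl) : V) := rfl
  rw [hw] at h1 h2
  obtain ⟨-, h3, h4⟩ := hc.smul_add_mem_cone hN h1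
  rw [gammaIntegrand, Set.indicator_of_mem hx, Set.indicator_of_mem (Set.mem_Ioi.2 ht),
    gammaIntegrand, Set.indicator_of_mem h3, ← ENNReal.ofReal_mul (Real.exp_pos _).le,
    ← ENNReal.ofReal_mul (by positivity)]
  refine ENNReal.ofReal_le_ofReal ?_
  have e1 : ⟪v - t⁻¹ • q, (one : peirceOne hc.1.compl)⟫_ℝ =
      ⟪(v : V), one⟫_ℝ - t⁻¹ * (‖(u : V)‖ ^ 2 / 2) := by
    have hz : ∀ y : V, mul c y = 0 → ⟪y, c⟫_ℝ = 0 := fun y hy => by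
      rw [← show mul c c = c from hc.1, inner_mul_right, hy, inner_zero_left]
    rw [Submodule.coe_inner, coe_one_peirceOne, IsIdempotent.coe_compl, inner_sub_right,
      hz _ (hc.1.mem_peirceOne_compl.1 (v - t⁻¹ • q).2), ← hw, inner_sub_left,
      real_inner_smul_left, IsIdempotent.inner_halfSquare hu, sub_zero]
  have e2 : ⟪t • c + (u : V) + v, one⟫_ℝ = t + ⟪(v : V), one⟫_ℝ := by
    rw [inner_add_left, inner_add_left, real_inner_smul_left, hc.1.inner_one, hN c hc,
      hc.1.inner_half_one hu]
    ring
  rw [Real.rpow_def_of_pos ht, ← Real.exp_add, ← Real.exp_add, ← Real.exp_add, Real.exp_le_exp,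
    e1, e2, ← h2, h4]
  -- By the arithmetic-geometric mean inequality, half of the decay in `t` together with the trace
  -- of `t⁻¹ q` pays for decay in `‖u‖`; hence the rate `ε / 2` in `t`.
  have e3 : ‖(u : V)‖ ≤ t / 2 + t⁻¹ * (‖(u : V)‖ ^ 2 / 2) := by
    have : t / 2 + t⁻¹ * (‖(u : V)‖ ^ 2 / 2) - ‖(u : V)‖ = t⁻¹ * ((t - ‖(u : V)‖) ^ 2 / 2) := by
      field_simp; ring
    have h0 : 0 ≤ t⁻¹ * ((t - ‖(u : V)‖) ^ 2 / 2) := by positivity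
    linarith
  have e4 := mul_le_mul_of_nonneg_left e3 hε.le
  rw [Submodule.coe_norm]
  linarith

/-- The gamma integral of the cone converges for every exponent above `-1`. -/
theorem lintegral_gammaIntegrand_lt_top (n : ℕ) :
    ∀ {V : Type*} [NormedAddCommGroup V] [InnerProductSpace ℝ V] [FiniteDimensional ℝ V]
      [MeasurableSpace V] [BorelSpace V] [EuclideanJordanAlgebra V] (_ : IsNormalized V)
      {ε p : ℝ} (_ : 0 < ε) (_ : -1 < p), Module.finrank ℝ V = n →
      ∫⁻ x, gammaIntegrand V ε p x < ∞ := by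
  induction n using Nat.strong_induction_on with
  | _ n ih =>
    intro V _ _ _ _ _ _ hN ε p hε hp hn
    obtain ⟨m, d, l, hd, -⟩ := exists_jordanFrame (one : V)
    rcases Nat.eq_zero_or_pos m with hm | hm
    · subst hm
      have h1 : (one : V) = 0 := by rw [← hd.2.2]; simp
      have hsub : Subsingleton V := ⟨fun x y => by
        rw [← one_mul x, ← one_mul y, h1]; simp⟩
      have hfun : gammaIntegrand V ε p = fun _ => gammaIntegrand V ε p 0 := by
        funext x; rw [Subsingleton.elim x 0]
      rw [hfun, lintegral_const]
      refine ENNReal.mul_lt_top ?_ (Set.toFinite _).isCompact.measure_lt_top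
      rw [gammaIntegrand, Set.indicator]
      split_ifs
      · exact ENNReal.ofReal_lt_top
      · exact ENNReal.zero_lt_top
    · set c := d ⟨0, hm⟩
      have hc : IsPrimitive c := hd.1 _
      set W := peirceOne hc.1.compl with hW
      have hlt : Module.finrank ℝ W < n := by
        rw [← hn]
        refine Submodule.finrank_lt fun htop => hc.2.1 ?_
        have : c ∈ W := by rw [htop]; trivial
        rw [hW, hc.1.mem_peirceOne_compl] at this
        rw [← this, show mul c c = c from hc.1]
      have hNW : IsNormalized W := hN.peirceOne _
      have hfin := ih _ hlt (V := W) hNW hε hp rfl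
      let Φ : (ℝ × peirceHalf c × W) ≃L[ℝ] V :=
        (LinearEquiv.ofBijective (peirceMap hc) (bijective_peirceMap hN hc)).toContinuousLinearEquiv
      have hΦ : ∀ y, Φ y = peirceMap hc y := fun y => rfl
      -- Uniqueness of Haar measure gives the change of variables up to a finite constant, which
      -- suffices for convergence.
      have : (volume : Measure (ℝ × peirceHalf c × W)).IsAddHaarMeasure := by
        rw [Measure.volume_eq_prod]
        have : (volume : Measure (peirceHalf c × W)).IsAddHaarMeasure := by
          rw [Measure.volume_eq_prod]; infer_instance
        exact Measure.prod.instIsAddHaarMeasure _ _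
      have : (Measure.map Φ volume).IsAddHaarMeasure := Φ.isAddHaarMeasure_map _
      rw [Measure.isAddLeftInvariant_eq_smul (volume : Measure V) (Measure.map Φ volume),
        lintegral_smul_measure]
      refine ENNReal.mul_lt_top ENNReal.coe_lt_top ?_
      rw [lintegral_map (measurable_gammaIntegrand hN ε p) Φ.continuous.measurable]
      let Q : peirceHalf c → W := fun u => ⟨halfSquare c u, hc.1.mem_peirceOne_compl.2
            (hc.1.mul_halfSquare (mem_peirceHalf.1 u.2))⟩
      have hQ : Measurable Q :=
        (((continuous_halfSquare c).comp continuous_subtype_val).subtype_mk _).measurable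
      let A : ℝ → ℝ≥0∞ := (Set.Ioi (0 : ℝ)).indicator
        (fun t => ENNReal.ofReal (t ^ p * Real.exp (-(ε / 2) * t)))
      let B : peirceHalf c → ℝ≥0∞ := fun u => ENNReal.ofReal (Real.exp (-(ε * ‖u‖)))
      have hA : Measurable A := Measurable.indicator (by fun_prop) measurableSet_Ioi
      have hB : Measurable B := by fun_prop
      have hH := measurable_gammaIntegrand hNW ε p
      have hG : Measurable fun y : ℝ × peirceHalf c × W =>
          A y.1 * (B y.2.1 * gammaIntegrand W ε p (y.2.2 - y.1⁻¹ • Q y.2.1)) := by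
        refine (hA.comp measurable_fst).mul ((hB.comp (measurable_fst.comp measurable_snd)).mul
          (hH.comp ?_))
        exact (measurable_snd.comp measurable_snd).sub
          (measurable_fst.inv.smul (hQ.comp (measurable_fst.comp measurable_snd)))
      refine (lintegral_mono (g := fun y : ℝ × peirceHalf c × W =>
          A y.1 * (B y.2.1 * gammaIntegrand W ε p (y.2.2 - y.1⁻¹ • Q y.2.1)))
          fun y => ?_).trans_lt ?_
      · rw [hΦ]
        exact gammaIntegrand_peirceMap_le hN hc hε p y.1 y.2.1 y.2.2
      · rw [Measure.volume_eq_prod, lintegral_prod _ hG.aemeasurable]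
        have hin : ∀ t : ℝ, ∫⁻ y : peirceHalf c × W,
            A t * (B y.1 * gammaIntegrand W ε p (y.2 - t⁻¹ • Q y.1)) =
            A t * ((∫⁻ u, B u) * ∫⁻ w, gammaIntegrand W ε p w) := by
          intro t
          have hGt : Measurable fun y : peirceHalf c × W =>
              B y.1 * gammaIntegrand W ε p (y.2 - t⁻¹ • Q y.1) :=
            (hB.comp measurable_fst).mul (hH.comp (measurable_snd.sub
              ((hQ.comp measurable_fst).const_smul t⁻¹)))
          rw [lintegral_const_mul _ hGt, Measure.volume_eq_prod,
            lintegral_prod _ hGt.aemeasurable]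
          congr 1
          rw [← lintegral_mul_const _ hB]
          refine lintegral_congr fun u => ?_
          -- Translation invariance in `W` removes the shift by `t⁻¹ • Q u`, decoupling the
          -- variables.
          exact (lintegral_const_mul (B u)
            (hH.comp (measurable_id.sub_const (t⁻¹ • Q u)))).trans
            (congrArg (B u * ·) (lintegral_sub_right_eq_self _ _))
        simp only [hin]
        rw [lintegral_mul_const _ hA]
        exact ENNReal.mul_lt_top (lintegral_rpow_exp_lt_top (half_pos hε) hp)
          (ENNReal.mul_lt_top (lintegral_exp_neg_norm_lt_top hε) hfin)

end Integral
-- The kernel in `L²` and the Laplace transform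
section Kernel

variable {V : Type*} [NormedAddCommGroup V] [InnerProductSpace ℝ V] [EuclideanJordanAlgebra V]

theorem norm_expKernel (w : V × V) (x : V) :
    ‖expKernel w x‖ = Real.exp (-⟪(cayley w).1, x⟫_ℝ) := by
  rw [expKernel, Complex.norm_exp]
  simp [cinner]

theorem conj_exp_neg_cinner (w : V × V) (x : V) :
    conj (Complex.exp (-cinner (cayley w) x)) = expKernel w x := by
  rw [expKernel, ← Complex.exp_conj, map_neg]

theorem continuous_expKernel (w : V × V) : Continuous (expKernel w) := by
  unfold expKernel cinner
  fun_prop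

variable [FiniteDimensional ℝ V] [MeasurableSpace V] [BorelSpace V]

theorem memLp_expKernel (hN : IsNormalized V) {ν : ℝ} (hν : dimOverRank V - 1 < ν) {w : V × V}
    (hw : (cayley w).1 ∈ cone V) : MemLp (expKernel w) 2 (coneMeasure V ν) := by
  refine ⟨(continuous_expKernel w).aestronglyMeasurable, ?_⟩
  rw [eLpNorm_lt_top_iff_lintegral_rpow_enorm_lt_top two_ne_zero ENNReal.ofNat_ne_top]
  obtain ⟨ε, hε, hy⟩ := (mem_cone_iff hN).1 hw
  set p := ν - dimOverRank V with hp
  have hms : MeasurableSet (cone V) := isOpen_cone.measurableSet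
  -- On the cone the density is the gamma integrand with `ε = 0`, which is known to be measurable.
  have hdens : coneMeasure V ν = (volume.restrict (cone V)).withDensity (gammaIntegrand V 0 p) := by
    rw [coneMeasure]
    refine withDensity_congr_ae ((ae_restrict_iff' hms).2 (Filter.Eventually.of_forall ?_))
    intro x hx
    simp only [gammaIntegrand, Set.indicator_of_mem hx, Real.rpow_def_of_pos (det_pos hN hx)]
    congr 2
    rw [hp]
    ring
  have hmeas : Measurable fun x => ‖expKernel w x‖ₑ ^ (2 : ℝ≥0∞).toReal :=
    (continuous_expKernel w).measurable.enorm.pow_const _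
  rw [hdens, lintegral_withDensity_eq_lintegral_mul _ (measurable_gammaIntegrand hN 0 p) hmeas]
  refine lt_of_le_of_lt ?_ (lintegral_gammaIntegrand_lt_top _ hN (ε := 2 * ε) (p := p)
    (by positivity) (by linarith) rfl)
  rw [← lintegral_indicator hms]
  refine lintegral_mono fun x => ?_
  refine Set.indicator_apply_le fun hx => ?_
  rw [Pi.mul_apply, gammaIntegrand, gammaIntegrand, Set.indicator_of_mem hx,
    Set.indicator_of_mem hx, ← ofReal_norm, norm_expKernel, ENNReal.toReal_ofNat,
    ENNReal.ofReal_rpow_of_pos (Real.exp_pos _), ← Real.exp_mul,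
    ← ENNReal.ofReal_mul (Real.exp_pos _).le, ← Real.exp_add]
  refine ENNReal.ofReal_le_ofReal (Real.exp_le_exp.2 ?_)
  have h := inner_cone_nonneg hy hx
  rw [inner_sub_left, real_inner_smul_left, real_inner_comm x one] at h
  linarith

theorem inner_toLp_expKernel {ν : ℝ} {w : V × V}
    (hmem : MemLp (expKernel w) 2 (coneMeasure V ν)) (f : L2Cone V ν) :
    ⟪f, hmem.toLp (expKernel w)⟫_ℂ = conj (laplace ν f (cayley w)) := by
  rw [L2.inner_def, laplace, ← integral_conj]
  refine integral_congr_ae ?_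
  filter_upwards [hmem.coeFn_toLp] with x hx
  rw [hx, map_mul, conj_exp_neg_cinner, RCLike.inner_apply]

theorem conj_xi {ν : ℝ} {w : V × V} (hmem : MemLp (expKernel w) 2 (coneMeasure V ν))
    (f : L2Cone V ν) :
    conj (xi ν f w) = (betaConst V ν : ℂ) * conj (cdetPow (oneC - w) (-(ν : ℂ))) *
      ⟪f, hmem.toLp (expKernel w)⟫_ℂ := by
  rw [inner_toLp_expKernel, xi, map_mul, map_mul, Complex.conj_ofReal]

end Kernel
end EuclideanJordanAlgebra

end

/-! ### The expansion of the projected kernel -/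

theorem mainTheorem2 {V : Type*} [NormedAddCommGroup V] [InnerProductSpace ℝ V]
    [FiniteDimensional ℝ V] [MeasurableSpace V] [BorelSpace V] [EuclideanJordanAlgebra V]
    (hsimple : EuclideanJordanAlgebra.IsSimple V)
    (htrace : ∀ x y : V,
      ⟪x, y⟫_ℝ = EuclideanJordanAlgebra.trace (EuclideanJordanAlgebra.mul x y))
    (ν : ℝ) (hν : EuclideanJordanAlgebra.dimOverRank V - 1 < ν)
    (E : Submodule ℂ (EuclideanJordanAlgebra.L2Cone V ν))
    (hE : IsClosed (E : Set (EuclideanJordanAlgebra.L2Cone V ν)))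
    {ι : Type*} (e : HilbertBasis ι ℂ E)
    (w : V × V) (hw : w ∈ EuclideanJordanAlgebra.boundedDomain V) :
    ∃ hmem : MemLp (EuclideanJordanAlgebra.expKernel w) 2
        (EuclideanJordanAlgebra.coneMeasure V ν),
      haveI : CompleteSpace E := hE.completeSpace_coe
      HasSum
        (fun α : ι => conj (EuclideanJordanAlgebra.xi ν (e α : EuclideanJordanAlgebra.L2Cone V ν) w)
          • (e α : EuclideanJordanAlgebra.L2Cone V ν))
        (((EuclideanJordanAlgebra.betaConst V ν : ℂ) *
            conj (EuclideanJordanAlgebra.cdetPow (EuclideanJordanAlgebra.oneC - w) (-(ν : ℂ))))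
          • E.starProjection (hmem.toLp (EuclideanJordanAlgebra.expKernel w))) := by
  have hN := EuclideanJordanAlgebra.isNormalized_of_trace htrace
  have hmem := EuclideanJordanAlgebra.memLp_expKernel hN hν hw.2
  refine ⟨hmem, ?_⟩
  have hcomplete : CompleteSpace E := hE.completeSpace_coe
  -- The Fourier series of the projected kernel inside `E`, carried to `L²` by the continuous
  -- inclusion.
  have h := (e.hasSum_repr (E.orthogonalProjectionOnto
    (hmem.toLp (EuclideanJordanAlgebra.expKernel w)))).mapL E.subtypeL
  have h2 := h.const_smul ((EuclideanJordanAlgebra.betaConst V ν : ℂ) *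
    conj (EuclideanJordanAlgebra.cdetPow (EuclideanJordanAlgebra.oneC - w) (-(ν : ℂ))))
  convert h2 using 1
  · funext α
    rw [EuclideanJordanAlgebra.conj_xi hmem, e.repr_apply_apply,
      Submodule.inner_orthogonalProjectionOnto_eq_of_mem_left, map_smul, smul_smul]
    rfl
  · rfl
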